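/- Let $\mathbf{k}$ be a field and let $R=\mathbf{k}\{x_1,\dots,x_n;Q,\preceq\}$ be a PBW algebra. That is, $R$ is an associative unital $\mathbf{k}$-algebra, the standard monomials $x^{\alpha}=x_1^{\alpha_1}\cdots x_n^{\alpha_n}$ ($\alpha\in\mathbb{N}^n$) form a $\mathbf{k}$-basis of $R$, and $Q$ is a set of relations $x_jx_i=q_{ji}x_ix_j+p_{ji}$ ($1\le i<j\le n$) holding in $R$, with $0\ne q_{ji}\in\mathbf{k}$, $p_{ji}\in R$ and $\exp(p_{ji})\prec\epsilon_i+\epsilon_j$. Here $\preceq$ is an admissible order on $\mathbb{N}^n$ (a total order with $0\preceq\alpha$ for all $\alpha$, and with $\alpha+\gamma\preceq\beta+\gamma$ whenever $\alpha\preceq\beta$), $\epsilon_i$ is the $i$-th unit vector, $\mathcal N(f)$ is the set of exponents of the standard monomials occurring in $f$, $\exp(f)=\max_{\preceq}\mathcal N(f)$ for $f\neq 0$, and $\exp(0)=-\infty$. Let $$\Phi_Q=\{w\in\mathbb{R}^n:\ w_l>0 \text{ for all } l,\ \langle w,\alpha\rangle<w_i+w_j\text{ for all } i<j \text{ and }\alpha\in\mathcal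 N(p_{ji})\}.$$ For $w\in\mathbb{N}^n$ with all $w_i>0$, let $\preceq_w$ be the order on $\mathbb{N}^n$ that first compares $|\alpha|_w=\sum_i w_i\alpha_i$ and breaks ties by the lexicographical order with $\epsilon_1\prec_{lex}\cdots\prec_{lex}\epsilon_n$. Extend $\preceq_w$ to a total order on $\mathbb{N}^n\times\{1,\dots,m\}$ that is compatible with translation by $\mathbb{N}^n$ and restricts to $\preceq_w$ on each $\mathbb{N}^n\times\{i\}$ (for instance "term over position" or "position over term"). Let $e_1,\dots,e_m$ be the canonical basis of $R^m$. For a left submodule $K\subseteq R^m$ let $\operatorname{Exp}(K)$ be the set of all $\exp(f)$, $0\ne f\in K$, where $\exp(f)$ is the largest $(\alpha,i)$ such that $x^\alpha e_i$ occurs in $f$. For $f:\mathbb{N}\to[0,\infty)$ put $d(f)=\inf\{\nu\in\mathbb{R}: f(s)\le s^\nu\text{ for } s\gg0\}$. A finite dimensional standard filtration of $R$ is a filtration of $R$ by finite dimensional subspaces $R_s$ ($s\in\mathbb{N}$) with $R_0=\mathbf{k}$ and $R_s=(R_1)^s$. The Gelfand-Kirillov dimension $\operatorname{GKdim} R$ is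 $d(s\mapsto\dim_{\mathbf{k}} R_s)$. For a finitely generated left $R$-module $M$, $\operatorname{GKdim} M$ is $d(s\mapsto\dim_{\mathbf{k}} R_sM_0)$, where $M_0$ is the $\mathbf{k}$-span of a finite set of generators of $M$. These values do not depend on the choice of the standard filtration and of the generators. **Corollary.** Let $M=R^m/K$, where $K$ is a left submodule of $R^m$, and let $w\in\Phi_Q$ be a weight vector with strictly positive integer components. Then the set $E=\operatorname{Exp}(K)$, computed with respect to $\preceq_w$, is stable ($E+\mathbb{N}^n=E$). There is a (unique) polynomial $HP_E$ with rational coefficients such that $HP_E(s)=\operatorname{card}\{(\alpha,i)\in(\mathbb{N}^n\times\{1,\dots,m\})\setminus E:\ \alpha_1+\dots+\alpha_n\le s\}$ for all large integers $s$. The Gelfand-Kirillov dimension of $M$ equals the degree of $HP_E$ (both are $-\infty$ if $M=0$). In particular, $\operatorname{GKdim} R=n$. -/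

import Mathlib

namespace PBW

open Filter

/-! ### Growth degree and Gelfand-Kirillov dimension -/

/-- The growth degree `inf {ν ∈ ℝ : f s ≤ s ^ ν for s ≫ 0}`, as an extended real number. -/
noncomputable def growthDegree (f : ℕ → ℝ) : EReal :=
  sInf {d : EReal | ∃ ν : ℝ, d = (ν : EReal) ∧ ∀ᶠ s : ℕ in atTop, f s ≤ (s : ℝ) ^ ν}

section GKdim

variable (k : Type*) (R : Type*) [Field k] [Ring R] [Algebra k R]

/-- A filtration of the `k`-algebra `R` by vector subspaces. -/
structure IsFiltration (F : ℕ → Submodule k R) : Prop where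
  mul_le : ∀ i j, F i * F j ≤ F (i + j)
  mono : ∀ i j, i ≤ j → F i ≤ F j
  exhaustive : ∀ r : R, ∃ s, r ∈ F s

/-- A finite dimensional standard filtration: `F 0 = k` and `F s = (F 1) ^ s`. -/
structure IsFinStandardFiltration (F : ℕ → Submodule k R) : Prop
    extends IsFiltration k R F where
  finite : ∀ s, FiniteDimensional k (F s)
  zero : F 0 = 1
  standard : ∀ s, F s = F 1 ^ s

/-- The Gelfand-Kirillov dimension of the affine algebra `R` is `d`: there are finite dimensional
standard filtrations, and `s ↦ dim R_s` has growth degree `d` for every one of them. -/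
def HasAlgebraGKdim (d : EReal) : Prop :=
  (∃ F : ℕ → Submodule k R, IsFinStandardFiltration k R F) ∧
  ∀ F : ℕ → Submodule k R, IsFinStandardFiltration k R F →
    growthDegree (fun s => (Module.finrank k (F s) : ℝ)) = d

variable (M : Type*) [AddCommGroup M] [Module k M] [Module R M]

variable {k R M} in
/-- The vector subspace `V U` of `M` spanned by all products `v u` with `v ∈ V`, `u ∈ U`. -/
def smulSpan (V : Submodule k R) (U : Submodule k M) : Submodule k M :=
  Submodule.span k {y | ∃ v ∈ V, ∃ u ∈ U, y = v • u}

/-- The Gelfand-Kirillov dimension of the finitely generated left module `M` over the affine algebra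
`R` is `d`: for every finite dimensional standard filtration `R_s` and every finite generating
set `S` of `M`, with linear span `M_0`, the function `s ↦ dim (R_s M_0)` has growth degree `d`
(and such filtrations and generating sets exist). -/
def HasModuleGKdim (d : EReal) : Prop :=
  (∃ F : ℕ → Submodule k R, IsFinStandardFiltration k R F) ∧
  (∃ S : Set M, S.Finite ∧ Submodule.span R S = ⊤) ∧
  ∀ (F : ℕ → Submodule k R) (S : Set M), IsFinStandardFiltration k R F →
    S.Finite → Submodule.span R S = ⊤ →
    growthDegree (fun s => (Module.finrank k (smulSpan (F s) (Submodule.span k S)) : ℝ)) = d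

end GKdim

/-! ### Orderings and exponents -/

/-- A (reflexive) total order given as a relation. -/
structure IsTotalOrder {σ : Type*} (le : σ → σ → Prop) : Prop where
  refl : ∀ a, le a a
  trans : ∀ a b c, le a b → le b c → le a c
  antisymm : ∀ a b, le a b → le b a → a = b
  total : ∀ a b, le a b ∨ le b a

/-- Admissible orderings on `ℕ^n`. -/
structure IsAdmissible {n : ℕ} (le : (Fin n → ℕ) → (Fin n → ℕ) → Prop) : Prop
    extends IsTotalOrder le where
  zero_le : ∀ α, le 0 α
  add_le : ∀ α β γ, le α β → le (α + γ) (β + γ)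

/-- `a` is the largest element of `N` for the ordering `le`. With `N` the Newton diagram of `f`
this says that `a` is the exponent of `f`. -/
def IsExponentOf {σ : Type*} (le : σ → σ → Prop) (N : Set σ) (a : σ) : Prop :=
  a ∈ N ∧ ∀ b ∈ N, le b a

/-- The standard monomial `x_1 ^ α_1 ⋯ x_n ^ α_n`. -/
def stdMonomial {R : Type*} [Ring R] {n : ℕ} (x : Fin n → R) (α : Fin n → ℕ) : R :=
  (List.ofFn fun i => x i ^ α i).prod

/-! ### PBW algebras -/

/-- `R = k{x_1, …, x_n; Q, ≼}` is a PBW algebra, with quantum relations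
`Q = {x_j x_i = q_{ji} x_i x_j + p_{ji} : i < j}` (the values of `q j i`, `p j i` for `j ≤ i`
play no role). -/
structure PBWAlgebra (k : Type*) (R : Type*) [Field k] [Ring R] [Algebra k R] (n : ℕ) where
  x : Fin n → R
  basis : Module.Basis (Fin n → ℕ) k R
  basis_eq : ∀ α, basis α = stdMonomial x α
  q : Fin n → Fin n → k
  p : Fin n → Fin n → R
  q_ne_zero : ∀ i j, i < j → q j i ≠ 0
  relation : ∀ i j, i < j → x j * x i = q j i • (x i * x j) + p j i
  le : (Fin n → ℕ) → (Fin n → ℕ) → Prop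
  admissible : IsAdmissible le
  /-- `exp p_{ji} ≺ ε_i + ε_j` (with `exp 0 = -∞`) -/
  bounded : ∀ i j, i < j → ∀ α, IsExponentOf le {β | basis.repr (p j i) β ≠ 0} α →
    le α (Pi.single i 1 + Pi.single j 1) ∧ α ≠ Pi.single i 1 + Pi.single j 1

namespace PBWAlgebra

variable {k : Type*} {R : Type*} [Field k] [Ring R] [Algebra k R] {n : ℕ}

/-- The Newton diagram of `f ∈ R`. -/
def newton (A : PBWAlgebra k R n) (f : R) : Set (Fin n → ℕ) :=
  {α | A.basis.repr f α ≠ 0}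

/-- The Newton diagram of `f ∈ R^m`: the exponents `(α, i)` such that `x^α e_i` occurs in `f`. -/
def newtonVec (A : PBWAlgebra k R n) {m : ℕ} (f : Fin m → R) : Set ((Fin n → ℕ) × Fin m) :=
  {a | A.basis.repr (f a.2) a.1 ≠ 0}

/-- `C_Q = ⋃_{i<j} (𝒩(p_{ji}) - ε_i - ε_j) ∪ {-ε_1, …, -ε_n}`. -/
def CQ (A : PBWAlgebra k R n) : Set (Fin n → ℤ) :=
  {γ | ∃ i j : Fin n, i < j ∧ ∃ α ∈ A.newton (A.p j i),
      γ = (fun l => (α l : ℤ)) - Pi.single i 1 - Pi.single j 1} ∪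
  {γ | ∃ i : Fin n, γ = -Pi.single i 1}

/-- The open polyhedron `Φ_Q = {w ∈ ℝ^n : ⟨w, γ⟩ < 0 for all γ ∈ C_Q}`. -/
def PhiQ (A : PBWAlgebra k R n) : Set (Fin n → ℝ) :=
  {w | ∀ γ ∈ A.CQ, ∑ l, w l * (γ l : ℝ) < 0}

/-- `Exp(K) = {exp f : 0 ≠ f ∈ K}` with respect to an ordering of `ℕ^n × {1, …, m}`. -/
def Exp (A : PBWAlgebra k R n) {m : ℕ}
    (le : (Fin n → ℕ) × Fin m → (Fin n → ℕ) × Fin m → Prop)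
    (K : Submodule R (Fin m → R)) : Set ((Fin n → ℕ) × Fin m) :=
  {a | ∃ f ∈ K, f ≠ 0 ∧ IsExponentOf le (A.newtonVec f) a}

end PBWAlgebra

/-! ### Weighted orderings and Hilbert functions -/

/-- The lexicographical order on `ℕ^n` with `ε_1 ≺ ⋯ ≺ ε_n`: the last differing entry decides. -/
def lexLe {n : ℕ} (α β : Fin n → ℕ) : Prop :=
  α = β ∨ ∃ i, α i < β i ∧ ∀ j, i < j → α j = β j

/-- `|α|_w = w_1 α_1 + ⋯ + w_n α_n`. -/
def wdeg {n : ℕ} (w α : Fin n → ℕ) : ℕ := ∑ i, w i * α i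

/-- The `w`-weighted lexicographical order `≼_w` on `ℕ^n`. -/
def weightLe {n : ℕ} (w α β : Fin n → ℕ) : Prop :=
  wdeg w α < wdeg w β ∨ (wdeg w α = wdeg w β ∧ lexLe α β)

/-- `le` is an extension of `≼_w` to `ℕ^n × {1, …, m}`: a total order that is compatible with the
action of `ℕ^n` and restricts to `≼_w` at each level. Both "term over position" and "position over
term" are of this kind. -/
structure IsExtensionOfWeight {n m : ℕ} (w : Fin n → ℕ)
    (le : (Fin n → ℕ) × Fin m → (Fin n → ℕ) × Fin m → Prop) : Prop
    extends IsTotalOrder le where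
  add_le : ∀ α β γ i j, le (α, i) (β, j) → le (α + γ, i) (β + γ, j)
  restrict : ∀ α β i, le (α, i) (β, i) ↔ weightLe w α β

/-- Stable subsets of `ℕ^n × {1, …, m}`. -/
def IsStable {n m : ℕ} (E : Set ((Fin n → ℕ) × Fin m)) : Prop :=
  ∀ α i β, (α, i) ∈ E → (α + β, i) ∈ E

/-- `HF_E(s) = card {(α, i) ∉ E : |α| ≤ s}`. -/
noncomputable def hilbertFunction {n m : ℕ} (E : Set ((Fin n → ℕ) × Fin m)) (s : ℕ) : ℕ :=
  Set.ncard {a : (Fin n → ℕ) × Fin m | a ∉ E ∧ ∑ l, a.1 l ≤ s}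

/-- `P` is the Hilbert polynomial of `E`: it agrees with `HF_E` at all large integers. -/
def IsHilbertPolynomial {n m : ℕ} (E : Set ((Fin n → ℕ) × Fin m)) (P : Polynomial ℚ) : Prop :=
  ∀ᶠ s : ℕ in atTop, P.eval (s : ℚ) = (hilbertFunction E s : ℚ)

/-- The degree of a polynomial as an extended real number, `-∞` for the zero polynomial. -/
noncomputable def degreeEReal (P : Polynomial ℚ) : EReal :=
  open Classical in if P = 0 then ⊥ else ((P.natDegree : ℝ) : EReal)

end PBW

/-! Because `w` lies in `Φ_Q`, each tail `p_ji` has `w`-degree strictly below `w_i + w_j`. Modulo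
lower `w`-degree the generators therefore commute up to nonzero scalars, and `x^α x^β = c x^(α+β) +`
(lower `w`-degree) with `c ≠ 0` (`exists_basis_mul_basis_sub_mem_below`). Hence leading exponents
add under multiplication by monomials, and `Exp(K)` is stable. By Dickson's lemma it is finitely
generated, so inclusion-exclusion makes its Hilbert function eventually polynomial.

The dimension of `R_s M_0` is squeezed between two values of this Hilbert function. From below:
monomials outside `Exp(K)` are independent modulo `K`, and those of total degree at most `s` land in
`R_(ts+t') M_0`. From above: `R_s M_0` comes from vectors of weight at most linear in `s`, which
reduce to combinations of monomials outside `Exp(K)`; as all `w_i ≥ 1`, a weight bound is a bound on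
total degree. A linear change of argument does not affect the degree of growth
(`growthDegree_eq_degreeEReal`).

The delicate point is that reduction must not raise the weight. The order on `ℕ^n × {1, …, m}` may
put position first, so a leading term need not have maximal weight. `exists_shift` gives the `e_i`
degrees `c_i` for which the leading terms of a finite Gröbner basis do have maximal shifted weight;
these solve a system of difference constraints.

For `GKdim R = n` no weight is given. One is obtained from the admissible order by separating
finitely many positive differences of exponents from `0` (`exists_dot_pos`), and the same squeeze
applies with the count `(s + n).choose n`. -/

namespace PBW

open Filter

/-! ### Counting monomials outside a stable set -/

section Counting

variable {n : ℕ}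

/-- The exponents of total degree at most `s` that are not above any element of `G`. -/
def staircase (G : List (Fin n → ℕ)) (s : ℕ) : Set (Fin n → ℕ) :=
  {β | (∀ g ∈ G, ¬ g ≤ β) ∧ ∑ l, β l ≤ s}

lemma finite_sum_le (s : ℕ) : {β : Fin n → ℕ | ∑ l, β l ≤ s}.Finite := by
  refine (Set.finite_Iic (fun _ : Fin n => s)).subset fun β hβ l => ?_
  exact (Finset.single_le_sum (f := β) (fun _ _ => Nat.zero_le _) (Finset.mem_univ l)).trans hβ

lemma finite_staircase (G : List (Fin n → ℕ)) (s : ℕ) : (staircase G s).Finite :=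
  (finite_sum_le s).subset fun _ h => h.2

/-- A slack coordinate `s - ∑ β` turns the inequality into an equation in `n + 1` variables, counted
by stars and bars. -/
lemma ncard_sum_le (s : ℕ) : {β : Fin n → ℕ | ∑ l, β l ≤ s}.ncard = (s + n).choose n := by
  have h := Finset.card_finsuppAntidiag_nat_eq_choose (s := (Finset.univ : Finset (Fin (n + 1)))) s
  have h2 : ((s + n).choose n) = (Finset.univ.finsuppAntidiag s : Finset (Fin (n + 1) →₀ ℕ)).card := by
    rw [h, Finset.card_univ, Fintype.card_fin, show n + 1 + s - 1 = s + n by omega,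
      Nat.choose_symm_add]
  rw [h2, ← Set.ncard_coe_finset]
  symm
  refine Set.ncard_congr (fun f _ l => f (Fin.succ l)) ?_ ?_ ?_
  · intro f hf
    simp only [Finset.mem_coe, Finset.mem_finsuppAntidiag,
      Fin.sum_univ_succ] at hf
    simp only [Set.mem_ofPred_eq]
    omega
  · intro f g hf hg hfg
    simp only [Finset.mem_coe, Finset.mem_finsuppAntidiag, Fin.sum_univ_succ] at hf hg
    have h3 : ∀ l : Fin n, f l.succ = g l.succ := fun l => congrFun hfg l
    ext l
    refine Fin.cases ?_ h3 l
    have : ∑ l : Fin n, f l.succ = ∑ l : Fin n, g l.succ := Finset.sum_congr rfl fun l _ => h3 l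
    omega
  · intro β hβ
    refine ⟨Finsupp.equivFunOnFinite.symm (Fin.cons (s - ∑ l, β l) β), ?_, ?_⟩
    · simp only [Set.mem_ofPred_eq] at hβ
      simp [Fin.sum_univ_succ]
      omega
    · ext l; simp

/-- The points of the staircase of `G` above `a` are the translates `a + γ`, and `g ≤ a + γ` means
`g - a ≤ γ` for truncated subtraction. This is the inclusion-exclusion step that removes one
generator. -/
lemma ncard_staircase_cons (a : Fin n → ℕ) (G : List (Fin n → ℕ)) (s : ℕ) :
    (staircase (a :: G) (s + ∑ l, a l)).ncard + (staircase (G.map (· - a)) s).ncard =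
      (staircase G (s + ∑ l, a l)).ncard := by
  have hinj : Function.Injective (fun β : Fin n → ℕ => a + β) := add_right_injective a
  rw [← Set.ncard_image_of_injective (staircase (G.map (· - a)) s) hinj,
    ← Set.ncard_union_eq ?_ (finite_staircase _ _) ((finite_staircase _ _).image _)]
  · congr 1
    ext β
    simp only [staircase, Set.mem_union, Set.mem_ofPred_eq, Set.mem_image, List.mem_cons,
      forall_eq_or_imp, List.forall_mem_map]
    constructor
    · rintro (⟨⟨_, h⟩, hs⟩ | ⟨γ, ⟨h, hs⟩, rfl⟩)
      · exact ⟨h, hs⟩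
      · refine ⟨fun g hg hle => h g hg (tsub_le_iff_left.2 hle), ?_⟩
        simp only [Pi.add_apply, Finset.sum_add_distrib]; omega
    · rintro ⟨h, hs⟩
      by_cases hab : a ≤ β
      · obtain ⟨γ, rfl⟩ := exists_add_of_le hab
        refine Or.inr ⟨γ, ⟨fun g hg hle => h g hg (tsub_le_iff_left.1 hle), ?_⟩, rfl⟩
        simp only [Pi.add_apply, Finset.sum_add_distrib] at hs; omega
      · exact Or.inl ⟨⟨hab, h⟩, hs⟩
  · rw [Set.disjoint_left]
    rintro _ ⟨h, _⟩ ⟨γ, _, rfl⟩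
    exact h a (by simp) (by simp)

/-- The induction is on the length because the recursion also calls the modified list `G.map (· -
a)`. Removing `a` gives the polynomial `P(X) - Q(X - |a|)`. -/
lemma exists_polynomial_staircase (r : ℕ) : ∀ G : List (Fin n → ℕ), G.length = r →
    ∃ P : Polynomial ℚ, ∀ᶠ s : ℕ in atTop, P.eval (s : ℚ) = ((staircase G s).ncard : ℚ) := by
  induction r with
  | zero =>
    intro G hG
    obtain rfl := List.length_eq_zero_iff.1 hG
    refine ⟨Polynomial.preHilbertPoly ℚ n 0, Eventually.of_forall fun s => ?_⟩
    rw [Polynomial.preHilbertPoly_eq_choose_sub_add ℚ n (Nat.zero_le s)]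
    simp [staircase, ncard_sum_le]
  | succ r ih =>
    intro G hG
    obtain ⟨a, G, rfl⟩ := List.exists_cons_of_length_eq_add_one hG
    have hG' : G.length = r := by simpa using hG
    obtain ⟨P, hP⟩ := ih G hG'
    obtain ⟨Q, hQ⟩ := ih (G.map (· - a)) (by simpa using hG')
    refine ⟨P - Q.comp (Polynomial.X - Polynomial.C ((∑ l, a l : ℕ) : ℚ)), ?_⟩
    have hQ' := (tendsto_sub_atTop_nat (∑ l, a l)).eventually hQ
    filter_upwards [hP, hQ', eventually_ge_atTop (∑ l, a l)] with s h1 h2 h3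
    obtain ⟨t, rfl⟩ := Nat.exists_eq_add_of_le' h3
    have h4 := ncard_staircase_cons a G t
    rw [Nat.add_sub_cancel] at h2
    simp only [Polynomial.eval_sub, Polynomial.eval_comp, Polynomial.eval_X, Polynomial.eval_C, h1]
    rw [← h4]
    push_cast at h2 ⊢
    rw [add_sub_cancel_right, h2]
    ring

/-- Dickson's lemma for subsets of `ℕ^n` closed under translation. -/
lemma exists_finite_generators (U : Set (Fin n → ℕ)) (hU : ∀ α β, α ∈ U → α + β ∈ U) :
    ∃ G : Finset (Fin n → ℕ), ∀ β, β ∈ U ↔ ∃ g ∈ G, g ≤ β := by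
  have hfin : {x | Minimal (· ∈ U) x}.Finite := by
    have hanti : IsAntichain (· ≤ ·) {x | Minimal (· ∈ U) x} := setOfPred_minimal_antichain _
    exact WellQuasiOrderedLE.finite_of_isAntichain hanti
  refine ⟨hfin.toFinset, fun β => ⟨fun h => ?_, ?_⟩⟩
  · obtain ⟨g, hg, hm⟩ := exists_minimal_le_of_wellFoundedLT (· ∈ U) β h
    exact ⟨g, by simpa using hm, hg⟩
  · rintro ⟨g, hg, hle⟩
    obtain ⟨γ, rfl⟩ := exists_add_of_le hle
    exact hU _ _ (by simpa using (hfin.mem_toFinset.1 hg).1)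

lemma exists_finite_generators_vec {m : ℕ} (E : Set ((Fin n → ℕ) × Fin m)) (hE : IsStable E) :
    ∃ G : Finset ((Fin n → ℕ) × Fin m), (∀ g ∈ G, g ∈ E) ∧
      ∀ a, a ∈ E ↔ ∃ g ∈ G, g.2 = a.2 ∧ g.1 ≤ a.1 := by
  classical
  choose G hG using fun i : Fin m =>
    exists_finite_generators {α | (α, i) ∈ E} fun α β h => hE α i β h
  refine ⟨Finset.univ.biUnion fun i => (G i).image fun α => (α, i), ?_, ?_⟩
  · simp only [Finset.mem_biUnion, Finset.mem_image]
    rintro _ ⟨i, -, α, hα, rfl⟩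
    exact (hG i α).2 ⟨α, hα, le_rfl⟩
  · rintro ⟨β, i⟩
    refine (hG i β).trans ⟨?_, ?_⟩
    · rintro ⟨g, hg, hle⟩
      exact ⟨(g, i), by simpa using hg, rfl, hle⟩
    · simp only [Finset.mem_biUnion, Finset.mem_image]
      rintro ⟨_, ⟨j, -, α, hα, rfl⟩, rfl, hle⟩
      exact ⟨α, hα, hle⟩

lemma finite_sum_le_vec {m : ℕ} (s : ℕ) :
    {a : (Fin n → ℕ) × Fin m | ∑ l, a.1 l ≤ s}.Finite :=
  ((finite_sum_le s).prod (Set.finite_univ (α := Fin m))).subset fun _ h => ⟨h, trivial⟩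

lemma hilbertFunction_eq_sum {m : ℕ} (E : Set ((Fin n → ℕ) × Fin m)) (s : ℕ) :
    hilbertFunction E s = ∑ i, {β : Fin n → ℕ | (β, i) ∉ E ∧ ∑ l, β l ≤ s}.ncard := by
  classical
  have hfin : {a : (Fin n → ℕ) × Fin m | a ∉ E ∧ ∑ l, a.1 l ≤ s}.Finite :=
    (finite_sum_le_vec s).subset fun _ h => h.2
  rw [hilbertFunction, Set.ncard_eq_toFinset_card _ hfin,
    Finset.card_eq_sum_card_fiberwise (f := Prod.snd) (t := Finset.univ) (by simp)]
  refine Finset.sum_congr rfl fun i _ => ?_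
  rw [← Set.ncard_coe_finset]
  refine Set.ncard_congr (fun a _ => a.1) ?_ ?_ ?_
  · rintro ⟨β, j⟩ h
    simp only [Finset.coe_filter, Set.Finite.mem_toFinset, Set.mem_ofPred_eq] at h
    obtain ⟨h, rfl⟩ := h
    exact h
  · rintro ⟨β, j⟩ ⟨γ, l⟩ h h' rfl
    simp only [Finset.coe_filter, Set.Finite.mem_toFinset, Set.mem_ofPred_eq] at h h'
    rw [h.2, h'.2]
  · intro β h
    exact ⟨(β, i), by simpa using h, rfl⟩

theorem exists_isHilbertPolynomial {m : ℕ} (E : Set ((Fin n → ℕ) × Fin m)) (hE : IsStable E) :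
    ∃ P : Polynomial ℚ, IsHilbertPolynomial E P := by
  choose G hG using fun i : Fin m =>
    exists_finite_generators {α | (α, i) ∈ E} fun α β h => hE α i β h
  choose P hP using fun i => exists_polynomial_staircase _ (G i).toList rfl
  refine ⟨∑ i, P i, ?_⟩
  filter_upwards [eventually_all.2 hP] with s hs
  rw [hilbertFunction_eq_sum, Polynomial.eval_finsetSum, Nat.cast_sum]
  refine Finset.sum_congr rfl fun i _ => ?_
  rw [hs i]
  congr 2
  ext β
  have := hG i β
  simp only [Set.mem_ofPred_eq] at this
  simp [staircase, this]

end Counting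

/-! ### Growth degree of functions squeezed by polynomials -/

section Growth

open Asymptotics

/-- Every real exponent is admissible, so the infimum is `-∞`; this covers the zero module. -/
lemma growthDegree_eq_bot {f : ℕ → ℝ} (h : ∀ᶠ s in atTop, f s ≤ 0) : growthDegree f = ⊥ := by
  rw [EReal.eq_bot_iff_forall_lt]
  intro y
  refine lt_of_le_of_lt (sInf_le ⟨y - 1, rfl, ?_⟩) (EReal.coe_lt_coe_iff.2 (sub_one_lt y))
  filter_upwards [h] with s hs
  exact hs.trans (Real.rpow_nonneg (Nat.cast_nonneg s) _)

lemma growthDegree_le {f : ℕ → ℝ} {d : ℕ} (p : Polynomial ℝ) (hp : p.natDegree ≤ d)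
    (h : ∀ᶠ s : ℕ in atTop, f s ≤ p.eval (s : ℝ)) : growthDegree f ≤ ((d : ℝ) : EReal) := by
  refine EReal.le_of_forall_lt_iff_le.1 fun ν hν => sInf_le ⟨ν, rfl, ?_⟩
  have hν : (d : ℝ) < ν := EReal.coe_lt_coe_iff.1 hν
  have h1 : (fun x : ℝ => p.eval x) =O[atTop] fun x => (Polynomial.X ^ d : Polynomial ℝ).eval x :=
    Polynomial.isBigO_atTop_of_degree_le _ _ (by
      rw [Polynomial.degree_X_pow]; exact Polynomial.natDegree_le_iff_degree_le.1 hp)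
  have h2 : (fun x : ℝ => x ^ (d : ℝ)) =o[atTop] fun x : ℝ => x ^ ν :=
    by
    refine isLittleO_of_tendsto' ?_ ?_
    · filter_upwards [eventually_gt_atTop 0] with x hx h
      exact absurd h (Real.rpow_pos_of_pos hx ν).ne'
    · refine (tendsto_rpow_neg_atTop (sub_pos.2 hν)).congr' ?_
      filter_upwards [eventually_gt_atTop 0] with x hx
      rw [neg_sub, Real.rpow_sub hx]
  simp only [Polynomial.eval_pow, Polynomial.eval_X, Real.rpow_natCast] at h1 h2
  have h3 := ((h1.trans_isLittleO h2).comp_tendsto tendsto_natCast_atTop_atTop).bound one_pos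
  filter_upwards [h, h3] with s hs h3
  simp only [Function.comp_apply, one_mul, Real.norm_eq_abs] at h3
  rw [abs_of_nonneg (Real.rpow_nonneg (Nat.cast_nonneg s) ν)] at h3
  exact hs.trans ((le_abs_self _).trans h3)

/-- If `ν < deg p` were admissible, then `s^deg p ≤ K p(s) ≤ K (ts + t')^ν`. Since `ts + t' ≤ (t +
t') s` for `s ≥ 1`, this would bound `(ts + t')^(deg p - ν)`, which tends to infinity. Control of
`f` along one arithmetic progression is enough. -/
lemma le_growthDegree {f : ℕ → ℝ} {p : Polynomial ℝ} (hp : p ≠ 0) {t t' : ℕ} (ht : 0 < t)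
    (h0 : ∀ᶠ s : ℕ in atTop, 0 ≤ p.eval (s : ℝ))
    (h : ∀ᶠ s : ℕ in atTop, p.eval (s : ℝ) ≤ f (t * s + t')) :
    ((p.natDegree : ℝ) : EReal) ≤ growthDegree f := by
  refine le_sInf ?_
  rintro _ ⟨ν, rfl, hν⟩
  rw [EReal.coe_le_coe_iff]
  by_contra! hlt
  have hy : Tendsto (fun s : ℕ => t * s + t') atTop atTop :=
    tendsto_atTop_mono (fun s => (Nat.le_mul_of_pos_left s ht).trans (Nat.le_add_right _ _))
      tendsto_id
  have h1 : (fun x : ℝ => (Polynomial.X ^ p.natDegree : Polynomial ℝ).eval x) =O[atTop]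
      fun x => p.eval x :=
    Polynomial.isBigO_atTop_of_degree_le _ _ (by
      rw [Polynomial.degree_X_pow, Polynomial.degree_eq_natDegree hp])
  obtain ⟨K, hK, h1⟩ := (h1.comp_tendsto tendsto_natCast_atTop_atTop).exists_pos
  have h2 := h1.bound
  have hb : ∀ᶠ s : ℕ in atTop,
      ((t * s + t' : ℕ) : ℝ) ^ ((p.natDegree : ℝ) - ν) ≤ ((t + t' : ℕ) : ℝ) ^ p.natDegree * K := by
    filter_upwards [h0, h, h2, hy.eventually hν, eventually_ge_atTop 1] with s h0 h h2 h3 h4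
    simp only [Function.comp_apply, Polynomial.eval_pow, Polynomial.eval_X, Real.norm_eq_abs,
      abs_of_nonneg h0, abs_of_nonneg (pow_nonneg (Nat.cast_nonneg (α := ℝ) s) _)] at h2
    have hpos : (0 : ℝ) < ((t * s + t' : ℕ) : ℝ) := by
      have : 0 < t * s := Nat.mul_pos ht h4
      exact_mod_cast Nat.add_pos_left this t'
    have h5 : ((t * s + t' : ℕ) : ℝ) ≤ ((t + t' : ℕ) : ℝ) * s := by
      have : t * s + t' ≤ (t + t') * s := by nlinarith
      exact_mod_cast this
    rw [Real.rpow_sub hpos, Real.rpow_natCast, div_le_iff₀ (Real.rpow_pos_of_pos hpos _)]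
    calc ((t * s + t' : ℕ) : ℝ) ^ p.natDegree ≤ (((t + t' : ℕ) : ℝ) * s) ^ p.natDegree := by
          gcongr
      _ = ((t + t' : ℕ) : ℝ) ^ p.natDegree * (s : ℝ) ^ p.natDegree := mul_pow _ _ _
      _ ≤ ((t + t' : ℕ) : ℝ) ^ p.natDegree * (K * ((t * s + t' : ℕ) : ℝ) ^ ν) := by
          gcongr
          exact h2.trans (by gcongr; exact h.trans h3)
      _ = _ := by ring
  have ht' := (tendsto_rpow_atTop (sub_pos.2 hlt)).comp
    (tendsto_natCast_atTop_atTop.comp hy)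
  obtain ⟨s, hs1, hs2⟩ := (hb.and (ht'.eventually_gt_atTop _)).exists
  exact absurd hs1 (not_le.2 hs2)

theorem growthDegree_eq_degreeEReal {f : ℕ → ℝ} (P : Polynomial ℚ) {D D' t t' : ℕ}
    (ht : 0 < t) (h0 : ∀ᶠ s : ℕ in atTop, 0 ≤ P.eval (s : ℚ))
    (hup : ∀ᶠ s : ℕ in atTop, f s ≤ (P.eval ((D * s + D' : ℕ) : ℚ) : ℚ))
    (hlow : ∀ᶠ s : ℕ in atTop, ((P.eval (s : ℚ) : ℚ) : ℝ) ≤ f (t * s + t')) :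
    growthDegree f = degreeEReal P := by
  unfold degreeEReal
  split_ifs with hP
  · subst hP
    exact growthDegree_eq_bot (by simpa using hup)
  · have hev : ∀ x : ℚ, ((P.eval x : ℚ) : ℝ) = (P.map (algebraMap ℚ ℝ)).eval (x : ℝ) := fun x => by
      rw [← eq_ratCast (algebraMap ℚ ℝ) x, Polynomial.eval_map_algebraMap,
        Polynomial.aeval_algebraMap_apply]; simp
    have hdeg : (P.map (algebraMap ℚ ℝ)).natDegree = P.natDegree := Polynomial.natDegree_map _
    refine le_antisymm ?_ ?_
    · refine growthDegree_le ((P.map (algebraMap ℚ ℝ)).comp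
        (Polynomial.C (D : ℝ) * Polynomial.X + Polynomial.C (D' : ℝ))) ?_ ?_
      · refine Polynomial.natDegree_comp_le.trans ?_
        rw [hdeg]
        exact (Nat.mul_le_mul_left _ Polynomial.natDegree_linear_le).trans (mul_one _).le
      · filter_upwards [hup] with s hs
        rw [hev] at hs
        simpa using hs
    · rw [← hdeg]
      refine le_growthDegree ((Polynomial.map_ne_zero_iff (algebraMap ℚ ℝ).injective).2 hP) ht
        (t' := t') ?_ ?_
      · filter_upwards [h0] with s hs
        have := hev s
        rw [Rat.cast_natCast] at this
        rw [← this]; exact_mod_cast hs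
      · filter_upwards [hlow] with s hs
        rw [hev] at hs
        simpa using hs

end Growth

/-! ### Fourier-Motzkin elimination and difference constraints -/

section LinearInequalities

lemma nsmul_mem_of_add_mem {M : Type*} [AddMonoid M] {T : Set M}
    (hadd : ∀ u ∈ T, ∀ v ∈ T, u + v ∈ T) {u : M} (hu : u ∈ T) : ∀ r : ℕ, 0 < r → r • u ∈ T
  | 0, h => absurd h (lt_irrefl 0)
  | 1, _ => by rwa [one_nsmul]
  | r + 2, _ => by
    rw [succ_nsmul]
    exact hadd _ (nsmul_mem_of_add_mem hadd hu (r + 1) r.succ_pos) _ hu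

lemma zsmul_mem_of_add_mem {M : Type*} [AddGroup M] {T : Set M}
    (hadd : ∀ u ∈ T, ∀ v ∈ T, u + v ∈ T) {u : M} (hu : u ∈ T) {r : ℤ} (hr : 0 < r) :
    r • u ∈ T := by
  lift r to ℕ using hr.le
  rw [natCast_zsmul]
  exact nsmul_mem_of_add_mem hadd hu r (by exact_mod_cast hr)

/-- A finite set of vectors inside an additively closed set not containing `0` lies strictly
on one side of some hyperplane. -/
theorem exists_dot_pos (n : ℕ) : ∀ T : Set (Fin n → ℤ), (∀ u ∈ T, ∀ v ∈ T, u + v ∈ T) → 0 ∉ T →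
    ∀ C : Finset (Fin n → ℤ), (∀ u ∈ C, u ∈ T) →
      ∃ w : Fin n → ℤ, ∀ u ∈ C, 0 < ∑ l, w l * u l := by
  classical
  induction n with
  | zero =>
    intro T _ h0 C hC
    exact ⟨0, fun u hu => absurd (Subsingleton.elim u 0 ▸ hC u hu) h0⟩
  | succ n ih =>
    intro T hadd h0 C hC
    -- For `u 0 > 0 > v 0`, this positive combination of `u` and `v` stays in `T` and has vanishing
    -- coordinate `0`: Fourier-Motzkin elimination of that coordinate.
    let e : (Fin (n + 1) → ℤ) × (Fin (n + 1) → ℤ) → Fin (n + 1) → ℤ :=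
      fun z => (-z.2 0) • z.1 + z.1 0 • z.2
    obtain ⟨w, hw⟩ := ih {v | (Fin.cons 0 v : Fin (n + 1) → ℤ) ∈ T}
      (fun u hu v hv => by
        have h := hadd _ hu _ hv
        have h' : (Fin.cons 0 u : Fin (n + 1) → ℤ) + Fin.cons 0 v = Fin.cons 0 (u + v) := by
          ext l; refine Fin.cases ?_ (fun l => ?_) l <;> simp
        rw [h'] at h
        exact h)
      (fun h => h0 (by
        have h' : (Fin.cons 0 (0 : Fin n → ℤ) : Fin (n + 1) → ℤ) = 0 := by
          ext l; refine Fin.cases ?_ (fun l => ?_) l <;> simp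
        rw [← h']; exact h))
      ((C.filter fun u => u 0 = 0).image Fin.tail ∪
        (((C.filter fun u => 0 < u 0) ×ˢ (C.filter fun u => u 0 < 0)).image
          fun z => Fin.tail (e z)))
      (by
        have hcons : ∀ v ∈ T, v 0 = 0 → (Fin.cons 0 (Fin.tail v) : Fin (n + 1) → ℤ) ∈ T := by
          intro v hv h
          rwa [← h, Fin.cons_self_tail]
        intro u hu
        simp only [Finset.mem_union, Finset.mem_image, Finset.mem_filter, Finset.mem_product] at hu
        rcases hu with ⟨v, ⟨hv, h⟩, rfl⟩ | ⟨⟨v, v'⟩, ⟨⟨hv, h⟩, hv', h'⟩, rfl⟩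
        · exact hcons v (hC v hv) h
        · refine hcons _ (hadd _ ?_ _ ?_) ?_
          · exact zsmul_mem_of_add_mem hadd (hC v hv) (by simpa using h')
          · exact zsmul_mem_of_add_mem hadd (hC v' hv') h
          · change -v' 0 * v 0 + v 0 * v' 0 = 0
            ring)
    let φ : (Fin (n + 1) → ℤ) → ℤ := fun u => ∑ l, w l * u (Fin.succ l)
    -- With `r` as the missing coordinate of the functional, `r * u 0 + φ u > 0` says `r > ρ u` if
    -- `u 0 > 0` and `r < ρ u` if `u 0 < 0`. The inequalities for the `e (u, v)` say exactly that
    -- the lower bounds lie below the upper ones.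
    let ρ : (Fin (n + 1) → ℤ) → ℚ := fun u => -(φ u : ℚ) / (u 0 : ℚ)
    obtain ⟨r, hr1, hr2⟩ := Order.exists_between_finsets
      ((C.filter fun u => 0 < u 0).image ρ) ((C.filter fun u => u 0 < 0).image ρ) (by
        intro x hx y hy
        simp only [Finset.mem_image, Finset.mem_filter] at hx hy
        obtain ⟨u, ⟨hu, hu0⟩, rfl⟩ := hx
        obtain ⟨v, ⟨hv, hv0⟩, rfl⟩ := hy
        have h := hw (Fin.tail (e (u, v))) (Finset.mem_union_right _ (Finset.mem_image_of_mem _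
          (by simp [hu, hu0, hv, hv0])))
        have h' : ∑ l, w l * Fin.tail (e (u, v)) l = -v 0 * φ u + u 0 * φ v := by
          simp only [φ, Finset.mul_sum, ← Finset.sum_add_distrib]
          refine Finset.sum_congr rfl fun l _ => ?_
          simp [e, Fin.tail]; ring
        rw [h'] at h
        have hq : (0 : ℚ) < -v 0 * φ u + u 0 * φ v := by exact_mod_cast h
        have hu0' : (0 : ℚ) < u 0 := by exact_mod_cast hu0
        have hv0' : (v 0 : ℚ) < 0 := by exact_mod_cast hv0
        simp only [ρ]
        rw [div_lt_iff₀ hu0', div_mul_eq_mul_div, lt_div_iff_of_neg hv0']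
        nlinarith)
    -- Scaling by the denominator of `r` makes the functional integral.
    refine ⟨Fin.cons r.num fun l => r.den * w l, fun u hu => ?_⟩
    have hden : (0 : ℚ) < r.den := by exact_mod_cast r.den_pos
    have hsum : ((∑ l, (Fin.cons r.num fun l => r.den * w l : Fin (n + 1) → ℤ) l * u l : ℤ) : ℚ) =
        r.den * (r * u 0 + φ u) := by
      have hnum : (r.num : ℚ) = r.den * r := by rw [mul_comm, Rat.mul_den_eq_num]
      rw [Fin.sum_univ_succ]
      simp only [Fin.cons_zero, Fin.cons_succ, φ]
      push_cast
      rw [hnum, mul_add, Finset.mul_sum]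
      congr 1
      · ring
      · exact Finset.sum_congr rfl fun l _ => by ring
    have hpos : (0 : ℚ) < r * u 0 + φ u := by
      rcases lt_trichotomy (u 0) 0 with h | h | h
      · have h1 := hr2 (ρ u) (Finset.mem_image_of_mem _ (by simp [hu, h]))
        have h2 : (u 0 : ℚ) < 0 := by exact_mod_cast h
        simp only [ρ] at h1
        rw [lt_div_iff_of_neg h2] at h1
        linarith
      · have h1 := hw (Fin.tail u) (Finset.mem_union_left _ (Finset.mem_image_of_mem _
          (by simp [hu, h])))
        have h2 : (0 : ℚ) < φ u := by exact_mod_cast h1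
        rw [h]; simpa using h2
      · have h1 := hr1 (ρ u) (Finset.mem_image_of_mem _ (by simp [hu, h]))
        have h2 : (0 : ℚ) < u 0 := by exact_mod_cast h
        simp only [ρ] at h1
        rw [div_lt_iff₀ h2] at h1
        linarith
    have : (0 : ℚ) < ((∑ l, (Fin.cons r.num fun l => r.den * w l : Fin (n + 1) → ℤ) l * u l : ℤ) : ℚ) := by
      rw [hsum]; exact mul_pos hden hpos
    exact_mod_cast this

lemma exists_between_finsets_le {α : Type*} [LinearOrder α] [Inhabited α] (A B : Finset α)
    (h : ∀ a ∈ A, ∀ b ∈ B, a ≤ b) : ∃ m, (∀ a ∈ A, a ≤ m) ∧ ∀ b ∈ B, m ≤ b := by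
  rcases A.eq_empty_or_nonempty with rfl | hA
  · rcases B.eq_empty_or_nonempty with rfl | hB
    · exact ⟨default, by simp, by simp⟩
    · exact ⟨B.min' hB, by simp, fun b hb => B.min'_le b hb⟩
  · exact ⟨A.max' hA, fun a ha => A.le_max' a ha, fun b hb => h _ (A.max'_mem hA) b hb⟩

/-- A finite system of difference constraints without positive cycles has a solution. The absence
of positive cycles is expressed by an ambient set `T` of constraints closed under composition. -/
theorem exists_potential {V : Type*} [DecidableEq V] {T : Set (V × V × ℤ)}
    (hcomp : ∀ i j l d e, (i, j, d) ∈ T → (j, l, e) ∈ T → (i, l, d + e) ∈ T)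
    (hdiag : ∀ i d, (i, i, d) ∈ T → d ≤ 0) (S : Finset V) :
    ∀ T₀ : Finset (V × V × ℤ), (∀ e ∈ T₀, e ∈ T ∧ e.1 ∈ S ∧ e.2.1 ∈ S) →
      ∃ c : V → ℤ, ∀ e ∈ T₀, c e.2.1 + e.2.2 ≤ c e.1 := by
  induction S using Finset.induction_on with
  | empty =>
    intro T₀ h
    exact ⟨0, fun e he => absurd (h e he).2.1 (Finset.notMem_empty _)⟩
  | insert v S hv ih =>
    intro T₀ h
    -- The vertex `v` is eliminated: each pair of constraints passing through `v` is replaced by its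
    -- composite.
    obtain ⟨c, hc⟩ := ih ((T₀.filter fun e => e.1 ≠ v ∧ e.2.1 ≠ v) ∪
        ((T₀.filter fun e => e.1 ≠ v ∧ e.2.1 = v) ×ˢ (T₀.filter fun e => e.1 = v ∧ e.2.1 ≠ v)).image
          fun z => (z.1.1, z.2.2.1, z.1.2.2 + z.2.2.2)) (by
      intro e he
      simp only [Finset.mem_union, Finset.mem_image, Finset.mem_filter, Finset.mem_product] at he
      rcases he with ⟨he, h1, h2⟩ | ⟨⟨⟨i, j, d⟩, ⟨j', l, d'⟩⟩, ⟨⟨he, h1, h2⟩, he', h1', h2'⟩, rfl⟩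
      · have := h e he
        simp only [Finset.mem_insert, h1, h2, false_or] at this
        exact this
      · have h3 := h _ he
        have h4 := h _ he'
        simp only at h1 h2 h1' h2' h3 h4 ⊢
        subst h2 h1'
        simp only [Finset.mem_insert, h1, h2', false_or] at h3 h4
        exact ⟨hcomp _ _ _ _ _ h3.1 h4.1, h3.2.1, h4.2.2⟩)
    -- Constraints starting at `v` bound its potential from below, those ending at `v` from above;
    -- the composites make the bounds compatible.
    obtain ⟨m, hm1, hm2⟩ := exists_between_finsets_le
      ((T₀.filter fun e => e.1 = v ∧ e.2.1 ≠ v).image fun e => c e.2.1 + e.2.2)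
      ((T₀.filter fun e => e.1 ≠ v ∧ e.2.1 = v).image fun e => c e.1 - e.2.2) (by
        intro a ha b hb
        simp only [Finset.mem_image, Finset.mem_filter] at ha hb
        obtain ⟨f, hf, rfl⟩ := ha
        obtain ⟨e, he, rfl⟩ := hb
        have := hc (e.1, f.2.1, e.2.2 + f.2.2) (Finset.mem_union_right _
          (Finset.mem_image.2 ⟨(e, f), by simp [he, hf], rfl⟩))
        simp only at this
        linarith)
    refine ⟨Function.update c v m, fun e he => ?_⟩
    by_cases h1 : e.1 = v <;> by_cases h2 : e.2.1 = v
    · have h3 := h e he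
      have h4 : e.2.2 ≤ 0 := hdiag v e.2.2 (by
        have : e = (v, v, e.2.2) := by rw [← h1]; ext <;> simp [h1, h2]
        rw [← this]; exact h3.1)
      simp [h1, h2, h4]
    · have := hm1 _ (Finset.mem_image_of_mem _ (Finset.mem_filter.2 ⟨he, h1, h2⟩))
      simpa [h1, h2] using this
    · have := hm2 _ (Finset.mem_image_of_mem _ (Finset.mem_filter.2 ⟨he, h1, h2⟩))
      simp only [h2, Function.update_self, ne_eq, h1, not_false_eq_true, Function.update_of_ne]
      linarith
    · have := hc e (Finset.mem_union_left _ (Finset.mem_filter.2 ⟨he, h1, h2⟩))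
      simpa [h1, h2] using this

end LinearInequalities

/-! ### Weights and their existence -/

section Weights

variable {n : ℕ}

lemma wdeg_add (w α β : Fin n → ℕ) : wdeg w (α + β) = wdeg w α + wdeg w β := by
  simp [wdeg, mul_add, Finset.sum_add_distrib]

lemma sum_le_wdeg {w : Fin n → ℕ} (hw : ∀ i, 0 < w i) (α : Fin n → ℕ) : ∑ l, α l ≤ wdeg w α :=
  Finset.sum_le_sum fun i _ => Nat.le_mul_of_pos_left _ (hw i)

lemma wdeg_single (w : Fin n → ℕ) (i : Fin n) : wdeg w (Pi.single i 1) = w i := by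
  simp [wdeg, Pi.single_apply]

lemma wdeg_le_of_weightLe {w α β : Fin n → ℕ} (h : weightLe w α β) : wdeg w α ≤ wdeg w β :=
  h.elim le_of_lt fun h => h.1.le

/-- A finite nonempty set has a largest element for a total order. -/
lemma exists_isExponentOf {σ : Type*} {le : σ → σ → Prop} (hle : IsTotalOrder le) {N : Set σ}
    (hfin : N.Finite) (hne : N.Nonempty) : ∃ a, IsExponentOf le N a := by
  induction N, hfin using Set.Finite.induction_on with
  | empty => exact absurd hne Set.not_nonempty_empty
  | @insert a s _ _ ih =>
    rcases s.eq_empty_or_nonempty with rfl | hs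
    · exact ⟨a, by simp, by simpa using hle.refl a⟩
    · obtain ⟨b, hb, hmax⟩ := ih hs
      rcases hle.total a b with h | h
      · exact ⟨b, Set.mem_insert_of_mem _ hb, by rintro x (rfl | hx); exacts [h, hmax x hx]⟩
      · exact ⟨a, Set.mem_insert _ _, by
          rintro x (rfl | hx)
          exacts [hle.refl _, hle.trans _ _ _ (hmax x hx) h]⟩

end Weights

namespace PBWAlgebra

variable {k : Type*} {R : Type*} [Field k] [Ring R] [Algebra k R] {n : ℕ}

/-- The weight vector `w` is strictly positive and dominates the tails of the relations. -/
structure IsWeight (A : PBWAlgebra k R n) (w : Fin n → ℕ) : Prop where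
  pos : ∀ i, 0 < w i
  lt : ∀ i j, i < j → ∀ α ∈ A.newton (A.p j i), wdeg w α < w i + w j

lemma isWeight_of_mem_PhiQ (A : PBWAlgebra k R n) {w : Fin n → ℕ} (hpos : ∀ i, 0 < w i)
    (hw : (fun i => (w i : ℝ)) ∈ A.PhiQ) : A.IsWeight w := by
  refine ⟨hpos, fun i j hij α hα => ?_⟩
  have h := hw _ (Or.inl ⟨i, j, hij, α, hα, rfl⟩)
  have h' : ∑ l, (w l : ℝ) * (((fun l => (α l : ℤ)) - Pi.single i 1 - Pi.single j 1 :
      Fin n → ℤ) l : ℝ) = (wdeg w α : ℝ) - w i - w j := by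
    simp [wdeg, mul_sub, Finset.sum_sub_distrib, Pi.single_apply]
  simp only at h
  rw [h'] at h
  have : (wdeg w α : ℝ) < ((w i + w j : ℕ) : ℝ) := by push_cast; linarith
  exact_mod_cast this

lemma finite_newton (A : PBWAlgebra k R n) (f : R) : (A.newton f).Finite :=
  (A.basis.repr f).hasFiniteSupport

/-- The differences `α - β` with `β ≺ α` form an additively closed set avoiding `0`. It contains
each `ε_i` and each `ε_i + ε_j - α` with `α ∈ 𝒩(p_ji)`, finitely many vectors in all, and a
functional positive on these is a weight. -/
lemma exists_isWeight (A : PBWAlgebra k R n) : ∃ w, A.IsWeight w := by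
  classical
  have hord := A.admissible
  let T : Set (Fin n → ℤ) :=
    {γ | ∃ α β : Fin n → ℕ, A.le β α ∧ β ≠ α ∧ γ = fun l => (α l : ℤ) - β l}
  have hle : ∀ {α β γ δ}, A.le α β → A.le γ δ → A.le (α + γ) (β + δ) := fun {α β γ δ} h h' =>
    hord.trans _ _ _ (hord.add_le _ _ γ h) (by
      rw [add_comm β, add_comm β]; exact hord.add_le _ _ β h')
  have hadd : ∀ u ∈ T, ∀ v ∈ T, u + v ∈ T := by
    rintro _ ⟨α, β, h, hne, rfl⟩ _ ⟨α', β', h', hne', rfl⟩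
    refine ⟨α + α', β + β', hle h h', fun heq => hne (hord.antisymm _ _ h ?_), ?_⟩
    · have h1 : A.le (β' + α) (α' + α) := hord.add_le _ _ _ h'
      rw [add_comm α' α, ← heq, add_comm β β'] at h1
      rcases hord.total α β with h2 | h2
      · exact h2
      · by_contra
        have h3 : β' + α = β' + β := hord.antisymm _ _ h1 (by
          rw [add_comm, add_comm _ α]; exact hord.add_le _ _ _ h2)
        exact hne (add_left_cancel h3).symm
    · ext l; simp; ring
  have h0 : (0 : Fin n → ℤ) ∉ T := by
    rintro ⟨α, β, -, hne, h⟩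
    refine hne (funext fun l => ?_)
    have := congrFun h l
    simp at this
    omega
  have hfin : {γ : Fin n → ℤ | ∃ i, γ = Pi.single i 1}.Finite :=
    (Set.finite_range fun i : Fin n => (Pi.single i 1 : Fin n → ℤ)).subset
      fun _ ⟨i, hi⟩ => ⟨i, hi.symm⟩
  have hfin' : (⋃ i : Fin n, ⋃ j : Fin n, (fun α : Fin n → ℕ => fun l : Fin n =>
      (((Pi.single i 1 + Pi.single j 1 : Fin n → ℕ) l : ℕ) : ℤ) - α l) ''
        (if i < j then A.newton (A.p j i) else ∅)).Finite := by
    refine Set.finite_iUnion fun i => Set.finite_iUnion fun j => Set.Finite.image _ ?_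
    split_ifs
    exacts [A.finite_newton _, Set.finite_empty]
  obtain ⟨w, hw⟩ := exists_dot_pos n T hadd h0 (hfin.union hfin').toFinset (by
    intro γ hγ
    rw [Set.Finite.mem_toFinset] at hγ
    rcases hγ with ⟨i, rfl⟩ | hγ
    · refine ⟨Pi.single i 1, 0, hord.zero_le _, fun h => ?_, ?_⟩
      · simpa using congrFun h i
      · ext l; simp [Pi.single_apply]
    · simp only [Set.mem_iUnion] at hγ
      obtain ⟨i, j, α, hα, rfl⟩ := hγ
      split_ifs at hα with hij
      -- Only the leading exponent of `p_ji` is bounded by assumption; all the others lie below it.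
      · obtain ⟨β, hβ⟩ := exists_isExponentOf hord.toIsTotalOrder (A.finite_newton (A.p j i)) ⟨α, hα⟩
        obtain ⟨h1, h2⟩ := A.bounded i j hij β hβ
        refine ⟨_, α, hord.trans _ _ _ (hβ.2 α hα) h1, ?_, rfl⟩
        rintro rfl
        exact h2 (hord.antisymm _ _ h1 (hβ.2 _ hα))
      · exact absurd hα (Set.notMem_empty _))
  have hpos : ∀ i, 0 < w i := fun i => by
    have := hw (Pi.single i 1) (by rw [Set.Finite.mem_toFinset]; exact Or.inl ⟨i, rfl⟩)
    simpa [Pi.single_apply] using this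
  have hnat : ∀ i, ((w i).toNat : ℤ) = w i := fun i => Int.toNat_of_nonneg (hpos i).le
  refine ⟨fun i => (w i).toNat, fun i => by simpa using hpos i, fun i j hij α hα => ?_⟩
  have h := hw (fun l => (((Pi.single i 1 + Pi.single j 1 : Fin n → ℕ) l : ℕ) : ℤ) - α l) (by
    rw [Set.Finite.mem_toFinset]
    refine Or.inr (Set.mem_iUnion.2 ⟨i, Set.mem_iUnion.2 ⟨j, α, ?_, rfl⟩⟩)
    rwa [if_pos hij])
  have h' : ∑ l, w l * ((((Pi.single i 1 + Pi.single j 1 : Fin n → ℕ) l : ℕ) : ℤ) - α l) =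
      w i + w j - ∑ l, w l * α l := by
    simp [mul_sub, mul_add, Finset.sum_sub_distrib, Finset.sum_add_distrib, Pi.single_apply]
  rw [h'] at h
  zify
  simp only [wdeg]
  push_cast
  simp only [hnat]
  linarith

end PBWAlgebra

/-! ### Words in the generators -/

section Words

variable {n : ℕ}

/-- The sorted word with content `α`. -/
def word (α : Fin n → ℕ) : List (Fin n) :=
  (List.ofFn fun i => List.replicate (α i) i).flatten

/-- The content of a word. -/
def content (u : List (Fin n)) : Fin n → ℕ := fun i => u.count i

/-- The weight of a word. -/
def wordWeight (w : Fin n → ℕ) (u : List (Fin n)) : ℕ := (u.map w).sum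

lemma content_append (u v : List (Fin n)) : content (u ++ v) = content u + content v := by
  ext i; simp [content]

lemma content_word (α : Fin n → ℕ) : content (word α) = α := by
  ext j
  simp [content, word, List.count_flatten, List.map_ofFn, List.sum_ofFn, List.count_replicate]

lemma wordWeight_append (w : Fin n → ℕ) (u v : List (Fin n)) :
    wordWeight w (u ++ v) = wordWeight w u + wordWeight w v := by
  simp [wordWeight]

lemma wordWeight_eq (w : Fin n → ℕ) (u : List (Fin n)) : wordWeight w u = wdeg w (content u) := by
  induction u with
  | nil => simp [wordWeight, wdeg, content]
  | cons i u ih =>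
    have h : content (i :: u) = Pi.single i 1 + content u := by
      ext j
      simp [content, List.count_cons, Pi.single_apply, add_comm, eq_comm (a := i)]
    rw [h, wdeg_add, wdeg_single, ← ih]
    simp [wordWeight]

lemma wordWeight_word (w α : Fin n → ℕ) : wordWeight w (word α) = wdeg w α := by
  rw [wordWeight_eq, content_word]

lemma length_word (α : Fin n → ℕ) : (word α).length = ∑ i, α i := by
  simp [word, List.length_flatten, List.map_ofFn, List.sum_ofFn]

lemma perm_word_content (u : List (Fin n)) : u.Perm (word (content u)) :=
  List.perm_iff_count.2 fun i => (congrFun (content_word (content u)) i).symm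

end Words

/-! ### Multiplication of monomials modulo lower weight -/

namespace PBWAlgebra

variable {k : Type*} {R : Type*} [Field k] [Ring R] [Algebra k R] {n : ℕ} (A : PBWAlgebra k R n)

/-- The product of the generators along a word. -/
def wordProd (u : List (Fin n)) : R := (u.map A.x).prod

lemma wordProd_append (u v : List (Fin n)) :
    A.wordProd (u ++ v) = A.wordProd u * A.wordProd v := by
  simp [wordProd]

lemma wordProd_word (α : Fin n → ℕ) : A.wordProd (word α) = A.basis α := by
  rw [A.basis_eq, stdMonomial, wordProd, word, List.map_flatten, List.prod_flatten, List.map_ofFn,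
    List.map_ofFn]
  congr 2
  ext i
  simp

lemma basis_zero : A.basis 0 = 1 := by
  rw [A.basis_eq, stdMonomial]; simp

/-- The span of the standard monomials of `w`-degree less than `s`. -/
def below (w : Fin n → ℕ) (s : ℕ) : Submodule k R :=
  Submodule.span k (A.basis '' {α | wdeg w α < s})

variable {A} {w : Fin n → ℕ}

lemma basis_mem_below {α : Fin n → ℕ} {s : ℕ} (h : wdeg w α < s) : A.basis α ∈ A.below w s :=
  Submodule.subset_span ⟨α, h, rfl⟩

lemma below_mono {s t : ℕ} (h : s ≤ t) : A.below w s ≤ A.below w t :=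
  Submodule.span_mono (Set.image_mono fun _ h' => lt_of_lt_of_le h' h)

lemma mem_below_iff {f : R} {s : ℕ} :
    f ∈ A.below w s ↔ ∀ α ∈ A.newton f, wdeg w α < s := by
  rw [below, Module.Basis.mem_span_image]
  exact ⟨fun h α hα => h (by simpa [newton] using hα), fun h α hα => h α (by simpa [newton] using hα)⟩

lemma exists_mem_below (w : Fin n → ℕ) (f : R) : ∃ s, f ∈ A.below w s := by
  obtain ⟨s, hs⟩ := ((A.finite_newton f).image (wdeg w)).bddAbove
  exact ⟨s + 1, mem_below_iff.2 fun α hα => Nat.lt_succ_of_le (hs ⟨α, hα, rfl⟩)⟩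

lemma finiteDimensional_below (hw : A.IsWeight w) (s : ℕ) : FiniteDimensional k (A.below w s) :=
  FiniteDimensional.span_of_finite k (((finite_sum_le s).subset fun α hα =>
    (sum_le_wdeg hw.pos α).trans (le_of_lt hα)).image _)

/-- A word is sorted by adjacent transpositions. Each costs a nonzero scalar and an error `a p_ji
b`, a combination of words of smaller weight, to which strong induction on the weight applies. -/
lemma exists_wordProd_sub_mem_below (hw : A.IsWeight w) (s : ℕ) : ∀ u : List (Fin n),
    wordWeight w u = s → ∃ c : k, c ≠ 0 ∧ A.wordProd u - c • A.basis (content u) ∈ A.below w s := by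
  induction s using Nat.strong_induction_on with
  | _ s ih =>
  have hlow : ∀ u, wordWeight w u < s → A.wordProd u ∈ A.below w s := by
    intro u hu
    obtain ⟨c, -, hc⟩ := ih _ hu u rfl
    rw [← sub_add_cancel (A.wordProd u) (c • A.basis (content u))]
    refine Submodule.add_mem _ (below_mono hu.le hc) (Submodule.smul_mem _ _ (basis_mem_below ?_))
    rwa [← wordWeight_eq]
  have hswap : ∀ (a b : List (Fin n)) (i j : Fin n), i < j → wordWeight w (a ++ i :: j :: b) = s →
      A.wordProd (a ++ j :: i :: b) - A.q j i • A.wordProd (a ++ i :: j :: b) ∈ A.below w s := by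
    intro a b i j hij hs
    have h1 : A.wordProd (a ++ j :: i :: b) - A.q j i • A.wordProd (a ++ i :: j :: b) =
        A.wordProd a * A.p j i * A.wordProd b := by
      have h := A.relation i j hij
      simp only [wordProd, List.map_append, List.map_cons, List.prod_append, List.prod_cons]
      rw [← mul_assoc (A.x j), h, ← mul_assoc (A.x i)]
      simp only [add_mul, mul_add, smul_mul_assoc, mul_smul_comm, mul_assoc]
      abel
    have h2 : A.p j i ∈ A.below w (w i + w j) := mem_below_iff.2 (hw.lt i j hij)
    rw [h1]
    generalize A.p j i = f at h2
    induction h2 using Submodule.span_induction with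
    | mem f hf =>
      obtain ⟨α, hα, rfl⟩ := hf
      rw [← wordProd_word, ← wordProd_append, ← wordProd_append]
      refine hlow _ ?_
      have : wdeg w α < w i + w j := hα
      simp only [wordWeight, List.map_append, List.map_cons, List.sum_append, List.sum_cons] at hs
      rw [wordWeight_append, wordWeight_append, wordWeight_word]
      simp only [wordWeight]
      omega
    | zero => simp
    | add f g _ _ hf hg => rw [mul_add, add_mul]; exact Submodule.add_mem _ hf hg
    | smul c f _ hf => rw [mul_smul_comm, smul_mul_assoc]; exact Submodule.smul_mem _ _ hf
  -- The contexts `a` and `b` are universally quantified so that, in the `cons` case, the common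
  -- first letter can move into `a`.
  have hperm : ∀ u v : List (Fin n), u.Perm v → ∀ a b : List (Fin n),
      wordWeight w (a ++ u ++ b) = s →
      ∃ c : k, c ≠ 0 ∧ A.wordProd (a ++ u ++ b) - c • A.wordProd (a ++ v ++ b) ∈ A.below w s := by
    intro u v h
    induction h with
    | nil => exact fun a b _ => ⟨1, one_ne_zero, by simp⟩
    | @cons i u v _ ihp =>
      intro a b hs
      have := ihp (a ++ [i]) b (by simpa using hs)
      simpa using this
    | swap i j l =>
      intro a b hs
      rcases lt_trichotomy i j with h | rfl | h
      · refine ⟨A.q j i, A.q_ne_zero i j h, ?_⟩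
        have := hswap a (l ++ b) i j h (by
          rw [← hs]; simp [wordWeight]; omega)
        simpa using this
      · exact ⟨1, one_ne_zero, by simp⟩
      -- Here the word is already in order and the swap puts it out of order, so the relation is
      -- used backwards and `q` is inverted.
      · have hq := A.q_ne_zero j i h
        refine ⟨(A.q i j)⁻¹, inv_ne_zero hq, ?_⟩
        have := Submodule.smul_mem _ (-(A.q i j)⁻¹) (hswap a (l ++ b) j i h (by simpa using hs))
        rw [smul_sub, smul_smul, neg_mul, inv_mul_cancel₀ hq, neg_smul, neg_smul, one_smul,
          sub_neg_eq_add, neg_add_eq_sub] at this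
        simpa using this
    | @trans u v t huv _ ih1 ih2 =>
      intro a b hs
      obtain ⟨c, hc, h1⟩ := ih1 a b hs
      obtain ⟨d, hd, h2⟩ := ih2 a b (by
        rw [← hs]
        exact (((huv.append_left a).append_right b).map w).sum_eq.symm)
      refine ⟨c * d, mul_ne_zero hc hd, ?_⟩
      have := Submodule.add_mem _ h1 (Submodule.smul_mem _ c h2)
      rwa [smul_sub, smul_smul, sub_add_sub_cancel] at this
  intro u hu
  obtain ⟨c, hc, h⟩ := hperm u _ (perm_word_content u) [] [] (by simpa using hu)
  refine ⟨c, hc, ?_⟩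
  simpa [wordProd_word] using h

theorem exists_basis_mul_basis_sub_mem_below (hw : A.IsWeight w) (α β : Fin n → ℕ) :
    ∃ c : k, c ≠ 0 ∧ A.basis α * A.basis β - c • A.basis (α + β) ∈ A.below w (wdeg w (α + β)) := by
  have h := exists_wordProd_sub_mem_below hw (wdeg w (α + β)) (word α ++ word β) (by
    rw [wordWeight_append, wordWeight_word, wordWeight_word, wdeg_add])
  simpa only [wordProd_append, wordProd_word, content_append, content_word] using h

lemma basis_mul_basis_mem_below (hw : A.IsWeight w) (α β : Fin n → ℕ) :
    A.basis α * A.basis β ∈ A.below w (wdeg w α + wdeg w β + 1) := by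
  obtain ⟨c, -, h⟩ := exists_basis_mul_basis_sub_mem_below hw α β
  rw [wdeg_add] at h
  rw [← sub_add_cancel (A.basis α * A.basis β) (c • A.basis (α + β))]
  refine Submodule.add_mem _ (below_mono (Nat.le_succ _) h)
    (Submodule.smul_mem _ _ (basis_mem_below ?_))
  rw [wdeg_add]; omega

/-- As `below` is strict, `below w (s + 1)` consists of the elements of `w`-degree at most `s`; this
is multiplicativity of the weight filtration. -/
lemma below_mul_below_le (hw : A.IsWeight w) (s t : ℕ) :
    A.below w (s + 1) * A.below w (t + 1) ≤ A.below w (s + t + 1) := by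
  rw [below, below, Submodule.span_mul_span, Submodule.span_le]
  rintro _ ⟨_, ⟨α, hα, rfl⟩, _, ⟨β, hβ, rfl⟩, rfl⟩
  have hα : wdeg w α < s + 1 := hα
  have hβ : wdeg w β < t + 1 := hβ
  exact below_mono (by omega) (basis_mul_basis_mem_below hw α β)

lemma one_mem_below : (1 : R) ∈ A.below w 1 := by
  rw [← A.basis_zero]; exact basis_mem_below (by simp [wdeg])

lemma pow_le_below (hw : A.IsWeight w) {V : Submodule k R} {D : ℕ} (hV : V ≤ A.below w (D + 1))
    (s : ℕ) : V ^ s ≤ A.below w (D * s + 1) := by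
  induction s with
  | zero => rw [pow_zero, Submodule.one_le]; exact one_mem_below
  | succ s ih =>
    rw [pow_succ]
    exact (mul_le_mul' ih hV).trans (below_mul_below_le hw _ _)

/-! ### Standard filtrations compared with the weight filtration -/

/-- A finite dimensional standard filtration grows at most linearly in the weight filtration. -/
lemma exists_filtration_le_below (hw : A.IsWeight w) {F : ℕ → Submodule k R}
    (hF : IsFinStandardFiltration k R F) : ∃ D, ∀ s, F s ≤ A.below w (D * s + 1) := by
  have hfg : (F 1).FG := (Submodule.fg_top _).1 (hF.finite 1).fg_top
  obtain ⟨S, hS⟩ := hfg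
  choose d hd using fun f : R => exists_mem_below (A := A) w f
  refine ⟨S.sup d, fun s => ?_⟩
  rw [hF.standard]
  refine pow_le_below hw ?_ s
  rw [← hS, Submodule.span_le]
  exact fun f hf => below_mono ((Finset.le_sup hf).trans (Nat.le_succ _)) (hd f)

variable (A)

/-- The generators lie in some layer of a filtration; so monomials of degree `r` lie in a layer
linear in `r`. -/
lemma exists_basis_mem_filtration {F : ℕ → Submodule k R} (hF : IsFinStandardFiltration k R F) :
    ∃ t, 0 < t ∧ ∀ (r : ℕ) (α : Fin n → ℕ), ∑ l, α l ≤ r → A.basis α ∈ F (t * r) := by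
  choose d hd using fun i => hF.exhaustive (A.x i)
  have hword : ∀ u : List (Fin n), A.wordProd u ∈ F ((Finset.univ.sup d + 1) * u.length) := by
    intro u
    induction u with
    | nil => simpa [wordProd, hF.zero] using ⟨1, map_one (algebraMap k R)⟩
    | cons i u ih =>
      have h := hF.mul_le _ _ (Submodule.mul_mem_mul (hF.mono _ _
        ((Finset.le_sup (Finset.mem_univ i)).trans (Nat.le_succ _)) (hd i)) ih)
      rw [List.length_cons, mul_add, mul_one, add_comm]
      simpa [wordProd] using h
  -- The `+ 1` keeps the factor positive even when the supremum is `0`, as the lower growth bound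
  -- requires.
  refine ⟨Finset.univ.sup d + 1, Nat.succ_pos _, fun r α hα => ?_⟩
  rw [← wordProd_word]
  refine hF.mono _ _ ?_ (hword _)
  rw [length_word]
  exact Nat.mul_le_mul_left _ hα

/-- The powers of `V = k + ∑ k x_i` work: they increase because `1 ∈ V`, and exhaust `R` because the
standard monomials are products of generators. -/
lemma exists_isFinStandardFiltration (A : PBWAlgebra k R n) : ∃ F : ℕ → Submodule k R, IsFinStandardFiltration k R F := by
  let V : Submodule k R := 1 ⊔ Submodule.span k (Set.range A.x)
  have h1 : 1 ≤ V := le_sup_left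
  have hx : ∀ i, A.x i ∈ V := fun i =>
    Submodule.mem_sup_right (Submodule.subset_span ⟨i, rfl⟩)
  have hword : ∀ u : List (Fin n), A.wordProd u ∈ V ^ u.length := by
    intro u
    induction u with
    | nil => simpa [wordProd] using ⟨1, map_one (algebraMap k R)⟩
    | cons i u ih =>
      rw [List.length_cons, pow_succ']
      simpa [wordProd] using Submodule.mul_mem_mul (hx i) ih
  have hmono : ∀ i j, i ≤ j → V ^ i ≤ V ^ j := fun i j h => pow_le_pow_right₀ h1 h
  have hVfg : V.FG := Submodule.FG.sup
    (by rw [Submodule.one_eq_span]; exact Submodule.fg_span (Set.finite_singleton 1))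
    (Submodule.fg_span (Set.finite_range _))
  refine ⟨fun s => V ^ s, ⟨⟨fun i j => (pow_add V i j).ge, hmono, fun r => ?_⟩,
    fun s => ?_, pow_zero V, fun s => by rw [pow_one]⟩⟩
  · have hr : r ∈ Submodule.span k (Set.range A.basis) := by rw [A.basis.span_eq]; trivial
    induction hr using Submodule.span_induction with
    | mem f hf =>
      obtain ⟨α, rfl⟩ := hf
      exact ⟨_, A.wordProd_word α ▸ hword _⟩
    | zero => exact ⟨0, Submodule.zero_mem _⟩
    | add f g _ _ hf hg =>
      obtain ⟨s, hs⟩ := hf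
      obtain ⟨t, ht⟩ := hg
      exact ⟨max s t, Submodule.add_mem _ (hmono _ _ (le_max_left _ _) hs)
        (hmono _ _ (le_max_right _ _) ht)⟩
    | smul c f _ hf =>
      obtain ⟨s, hs⟩ := hf
      exact ⟨s, Submodule.smul_mem _ _ hs⟩
  · exact Module.Finite.iff_fg.2 (hVfg.pow s)

end PBWAlgebra

/-- A minimal counterexample exists because `D` is finite, so `le` itself need not be well-founded.
-/
lemma IsTotalOrder.induction_of_finite {σ : Type*} {le : σ → σ → Prop} (hle : IsTotalOrder le)
    {D : Set σ} (hD : D.Finite) {p : σ → Prop}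
    (h : ∀ a ∈ D, (∀ b ∈ D, le b a → b ≠ a → p b) → p a) : ∀ a ∈ D, p a := by
  have hrev : IsTotalOrder fun a b => le b a :=
    ⟨hle.refl, fun a b c h1 h2 => hle.trans _ _ _ h2 h1, fun a b h1 h2 => hle.antisymm _ _ h2 h1,
      fun a b => hle.total b a⟩
  by_contra! hne
  obtain ⟨a, ha⟩ := hne
  obtain ⟨b, ⟨hb, hpb⟩, hmin⟩ :=
    exists_isExponentOf hrev (N := {a | a ∈ D ∧ ¬ p a}) (hD.subset fun _ h => h.1) ⟨a, ha⟩
  refine hpb (h b hb fun c hc hcb hne => ?_)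
  by_contra hpc
  exact hne (hle.antisymm _ _ hcb (hmin c ⟨hc, hpc⟩))

/-! ### Filtrations of finitely generated modules -/

section SmulSpan

variable {k R M : Type*} [Field k] [Ring R] [Algebra k R] [AddCommGroup M] [Module k M]
  [Module R M] [IsScalarTower k R M]

lemma smul_mem_smulSpan {V W : Submodule k R} {U : Submodule k M} {r : R} (hr : r ∈ V) {y : M}
    (hy : y ∈ smulSpan W U) : r • y ∈ smulSpan (V * W) U := by
  have : SMulCommClass R k M := IsScalarTower.to_smulCommClass'
  induction hy using Submodule.span_induction with
  | mem y hy =>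
    obtain ⟨v, hv, u, hu, rfl⟩ := hy
    exact Submodule.subset_span ⟨r * v, Submodule.mul_mem_mul hr hv, u, hu, (mul_smul _ _ _).symm⟩
  | zero => rw [smul_zero]; exact Submodule.zero_mem _
  | add y z _ _ hy hz => rw [smul_add]; exact Submodule.add_mem _ hy hz
  | smul c y _ hy => rw [smul_comm]; exact Submodule.smul_mem _ _ hy

lemma smulSpan_mono {k R M : Type*} [Field k] [Ring R] [Algebra k R] [AddCommGroup M] [Module k M]
    [Module R M] {V W : Submodule k R} (h : V ≤ W) (U : Submodule k M) :
    smulSpan V U ≤ smulSpan W U :=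
  Submodule.span_mono fun _ ⟨v, hv, u, hu, hy⟩ => ⟨v, h hv, u, hu, hy⟩

lemma exists_mem_smulSpan {F : ℕ → Submodule k R} (hF : IsFinStandardFiltration k R F) {S : Set M}
    (hS : Submodule.span R S = ⊤) (y : M) : ∃ s, y ∈ smulSpan (F s) (Submodule.span k S) := by
  have hy : y ∈ Submodule.span R S := by rw [hS]; trivial
  induction hy using Submodule.span_induction with
  | mem y hy =>
    refine ⟨0, Submodule.subset_span ⟨1, ?_, y, Submodule.subset_span hy, (one_smul R y).symm⟩⟩
    rw [hF.zero]; exact Submodule.one_le.1 le_rfl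
  | zero => exact ⟨0, Submodule.zero_mem _⟩
  | add y z _ _ hy hz =>
    obtain ⟨s, hs⟩ := hy
    obtain ⟨t, ht⟩ := hz
    exact ⟨max s t, Submodule.add_mem _ (smulSpan_mono (hF.mono _ _ (le_max_left _ _)) _ hs)
      (smulSpan_mono (hF.mono _ _ (le_max_right _ _)) _ ht)⟩
  | smul r y _ hy =>
    obtain ⟨s, hs⟩ := hy
    obtain ⟨t, ht⟩ := hF.exhaustive r
    exact ⟨t + s, smulSpan_mono (hF.mul_le _ _) _ (smul_mem_smulSpan ht hs)⟩

end SmulSpan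

/-! ### Leading exponents and division in free modules -/

namespace PBWAlgebra

variable {k : Type*} {R : Type*} [Field k] [Ring R] [Algebra k R] {n : ℕ} (A : PBWAlgebra k R n)

/-- The basis of `R^m` consisting of the elements `x^α e_i`. -/
noncomputable def vecBasis (m : ℕ) : Module.Basis ((Fin n → ℕ) × Fin m) k (Fin m → R) :=
  (Pi.basis fun _ : Fin m => A.basis).reindex
    ((Equiv.sigmaEquivProd (Fin m) (Fin n → ℕ)).trans (Equiv.prodComm _ _))

variable {A} {m : ℕ}

lemma vecBasis_apply (a : (Fin n → ℕ) × Fin m) :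
    A.vecBasis m a = Pi.single a.2 (A.basis a.1) := by
  simp [vecBasis, Pi.basis_apply]

lemma vecBasis_repr (f : Fin m → R) (a : (Fin n → ℕ) × Fin m) :
    (A.vecBasis m).repr f a = A.basis.repr (f a.2) a.1 := by
  rw [vecBasis, Module.Basis.repr_reindex_apply]
  exact Pi.basis_repr _ _ _

lemma mem_span_vecBasis {N : Set ((Fin n → ℕ) × Fin m)} {f : Fin m → R} :
    f ∈ Submodule.span k (A.vecBasis m '' N) ↔ A.newtonVec f ⊆ N := by
  rw [Module.Basis.mem_span_image]
  have : ((A.vecBasis m).repr f).support = A.newtonVec f := by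
    ext a; simp [newtonVec, vecBasis_repr]
  rw [this]

lemma finite_newtonVec (f : Fin m → R) : (A.newtonVec f).Finite := by
  refine ((A.vecBasis m).repr f).hasFiniteSupport.subset fun a ha => ?_
  rwa [Function.mem_support, vecBasis_repr]

lemma newtonVec_nonempty {f : Fin m → R} (hf : f ≠ 0) : (A.newtonVec f).Nonempty := by
  by_contra h
  rw [Set.not_nonempty_iff_eq_empty] at h
  refine hf ?_
  have := mem_span_vecBasis.2 h.subset
  simpa using this

variable {le : (Fin n → ℕ) × Fin m → (Fin n → ℕ) × Fin m → Prop} {w : Fin n → ℕ}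

/-- Recasts a leading exponent as a congruence modulo strictly smaller monomials, a form that can be
multiplied by `x^γ`. -/
lemma isExponentOf_newtonVec_iff (hle : IsTotalOrder le) {f : Fin m → R}
    {a : (Fin n → ℕ) × Fin m} : IsExponentOf le (A.newtonVec f) a ↔
      ∃ c : k, c ≠ 0 ∧
        f - c • A.vecBasis m a ∈ Submodule.span k (A.vecBasis m '' {b | le b a ∧ b ≠ a}) := by
  classical
  have hrepr : ∀ (c : k) b, b ∈ A.newtonVec (f - c • A.vecBasis m a) ↔
      A.basis.repr (f b.2) b.1 - (if a = b then c else 0) ≠ 0 := fun c b => by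
    change A.basis.repr _ _ ≠ 0 ↔ _
    rw [← vecBasis_repr, ← vecBasis_repr]
    simp [Finsupp.single_apply]
  constructor
  · intro h
    refine ⟨_, h.1, mem_span_vecBasis.2 fun b hb => ?_⟩
    rw [hrepr] at hb
    by_cases hba : a = b
    · subst hba; simp at hb
    · rw [if_neg hba, sub_zero] at hb
      exact ⟨h.2 b hb, Ne.symm hba⟩
  · rintro ⟨c, hc, h⟩
    rw [mem_span_vecBasis] at h
    constructor
    · by_contra ha
      have ha : A.basis.repr (f a.2) a.1 = 0 := not_not.1 ha
      exact (h ((hrepr c a).2 (by simpa [ha] using hc))).2 rfl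
    · intro b hb
      by_cases hba : a = b
      · exact hba ▸ hle.refl a
      · exact (h ((hrepr c b).2 (by rw [if_neg hba, sub_zero]; exact hb))).1

lemma exists_smul_vecBasis_sub_mem (hw : A.IsWeight w) (γ : Fin n → ℕ)
    (a : (Fin n → ℕ) × Fin m) : ∃ c : k, c ≠ 0 ∧
      A.basis γ • A.vecBasis m a - c • A.vecBasis m (γ + a.1, a.2) ∈
        Submodule.span k (A.vecBasis m '' {b | b.2 = a.2 ∧ wdeg w b.1 < wdeg w (γ + a.1)}) := by
  obtain ⟨c, hc, h⟩ := exists_basis_mul_basis_sub_mem_below hw γ a.1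
  refine ⟨c, hc, ?_⟩
  have h1 := Submodule.mem_map_of_mem (f := LinearMap.single k (fun _ : Fin m => R) a.2) h
  rw [below, Submodule.map_span, Set.image_image] at h1
  have h2 : A.basis γ • A.vecBasis m a - c • A.vecBasis m (γ + a.1, a.2) =
      LinearMap.single k (fun _ : Fin m => R) a.2
        (A.basis γ * A.basis a.1 - c • A.basis (γ + a.1)) := by
    rw [map_sub, map_smul, vecBasis_apply, vecBasis_apply, LinearMap.single_apply,
      LinearMap.single_apply, ← smul_eq_mul, Pi.single_smul]
  rw [h2]
  refine Submodule.span_mono ?_ h1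
  rintro _ ⟨α, hα, rfl⟩
  exact ⟨(α, a.2), ⟨rfl, hα⟩, vecBasis_apply _⟩

/-- Support bookkeeping: `x^γ` moves the exponent `b` to `γ + b` and otherwise produces only lower
weight in the same component. It is applied both to initial segments of `le` and to bounds on the
shifted weight. -/
lemma basis_smul_mem_span (hw : A.IsWeight w) (γ : Fin n → ℕ) {N N' : Set ((Fin n → ℕ) × Fin m)}
    (h : ∀ b ∈ N, ∀ β, β = γ + b.1 ∨ wdeg w β < wdeg w (γ + b.1) → (β, b.2) ∈ N') {f : Fin m → R}
    (hf : f ∈ Submodule.span k (A.vecBasis m '' N)) :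
    A.basis γ • f ∈ Submodule.span k (A.vecBasis m '' N') := by
  induction hf using Submodule.span_induction with
  | mem f hf =>
    obtain ⟨b, hb, rfl⟩ := hf
    obtain ⟨c, -, hc⟩ := exists_smul_vecBasis_sub_mem hw γ b
    rw [← sub_add_cancel (A.basis γ • A.vecBasis m b) (c • A.vecBasis m (γ + b.1, b.2))]
    refine Submodule.add_mem _ (Submodule.span_mono (Set.image_mono ?_) hc) (Submodule.smul_mem _ _
      (Submodule.subset_span ⟨_, h b hb _ (Or.inl rfl), rfl⟩))
    rintro ⟨β, j⟩ ⟨rfl, hβ⟩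
    exact h b hb β (Or.inr hβ)
  | zero => rw [smul_zero]; exact Submodule.zero_mem _
  | add f g _ _ hf hg => rw [smul_add]; exact Submodule.add_mem _ hf hg
  | smul c f _ hf => rw [smul_comm]; exact Submodule.smul_mem _ _ hf

/-- Translation compatibility keeps the smaller terms below `γ + a`, and the correction terms are
smaller because within one component `le` compares weights first. The leading coefficient is a
product of two nonzero scalars. -/
lemma isExponentOf_basis_smul (hw : A.IsWeight w) (hle : IsExtensionOfWeight w le)
    {f : Fin m → R} {a : (Fin n → ℕ) × Fin m} (hf : IsExponentOf le (A.newtonVec f) a)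
    (γ : Fin n → ℕ) : IsExponentOf le (A.newtonVec (A.basis γ • f)) (γ + a.1, a.2) := by
  rw [isExponentOf_newtonVec_iff hle.toIsTotalOrder] at hf ⊢
  obtain ⟨c, hc, hf⟩ := hf
  obtain ⟨d, hd, h⟩ := exists_smul_vecBasis_sub_mem hw γ a
  have hlow : ∀ β δ j, wdeg w β < wdeg w δ → le (β, j) (δ, j) ∧ β ≠ δ := fun β δ j hlt =>
    ⟨(hle.restrict _ _ _).2 (Or.inl hlt), by rintro rfl; exact lt_irrefl _ hlt⟩
  refine ⟨c * d, mul_ne_zero hc hd, ?_⟩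
  have h1 : A.basis γ • (f - c • A.vecBasis m a) ∈ Submodule.span k
      (A.vecBasis m '' {b | le b (γ + a.1, a.2) ∧ b ≠ (γ + a.1, a.2)}) := by
    refine basis_smul_mem_span hw γ ?_ hf
    rintro ⟨β, j⟩ ⟨hba, hne⟩ δ hδ
    have h2 : le (γ + β, j) (γ + a.1, a.2) := by
      rw [add_comm γ, add_comm γ]; exact hle.add_le _ _ _ _ _ hba
    have h3 : (γ + β, j) ≠ (γ + a.1, a.2) := fun h => hne (by
      rw [Prod.mk.injEq] at h
      exact Prod.ext (add_left_cancel h.1) h.2)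
    rcases hδ with rfl | hδ
    · exact ⟨h2, h3⟩
    · obtain ⟨h4, h5⟩ := hlow δ (γ + β) j hδ
      refine ⟨hle.trans _ _ _ h4 h2, fun h => h5 ?_⟩
      have h6 := hle.antisymm _ _ h4 (h.symm ▸ h2)
      exact (Prod.mk.inj h6).1
  have h2 : A.basis γ • A.vecBasis m a - d • A.vecBasis m (γ + a.1, a.2) ∈ Submodule.span k
      (A.vecBasis m '' {b | le b (γ + a.1, a.2) ∧ b ≠ (γ + a.1, a.2)}) := by
    refine Submodule.span_mono (Set.image_mono ?_) h
    rintro ⟨β, j⟩ ⟨rfl, hβ⟩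
    obtain ⟨h4, h5⟩ := hlow β _ a.2 hβ
    exact ⟨h4, fun h => h5 (Prod.mk.inj h).1⟩
  have h3 := Submodule.add_mem _ h1 (Submodule.smul_mem _ c h2)
  rwa [smul_sub, smul_sub, smul_smul, smul_comm (A.basis γ) c, sub_add_sub_cancel] at h3

theorem isStable_Exp (hw : A.IsWeight w) (hle : IsExtensionOfWeight w le)
    (K : Submodule R (Fin m → R)) : IsStable (A.Exp le K) := by
  rintro α i β ⟨f, hf, -, ha⟩
  have h := isExponentOf_basis_smul hw hle ha β
  rw [add_comm]
  refine ⟨A.basis β • f, K.smul_mem _ hf, fun h0 => ?_, h⟩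
  have := h.1
  rw [h0] at this
  simp [newtonVec] at this

/-- Shifting the degrees of the free generators makes finitely many exponents the terms of maximal
weight. -/
lemma exists_shift (hle : IsExtensionOfWeight w le) (G : Finset ((Fin n → ℕ) × Fin m))
    (f : (Fin n → ℕ) × Fin m → Fin m → R) (hf : ∀ g ∈ G, IsExponentOf le (A.newtonVec (f g)) g) :
    ∃ c : Fin m → ℕ, ∀ g ∈ G, ∀ b ∈ A.newtonVec (f g),
      wdeg w b.1 + c b.2 ≤ wdeg w g.1 + c g.2 := by
  classical
  -- A triple `(i, j, d)` records a comparison `x^β e_j ≼ x^α e_i` with weight gain `d`. Comparisons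
  -- compose after translation to a common middle term, and a loop has `d ≤ 0` because within one
  -- component `le` refines the weight; so there are no positive cycles.
  let T : Set (Fin m × Fin m × ℤ) :=
    {e | ∃ α β, le (β, e.2.1) (α, e.1) ∧ e.2.2 = (wdeg w β : ℤ) - wdeg w α}
  obtain ⟨c, hc⟩ := exists_potential (T := T)
    (by
      rintro i j l _ _ ⟨α, β, h, rfl⟩ ⟨γ, δ, h', rfl⟩
      refine ⟨α + γ, δ + β, hle.trans _ _ _ (hle.add_le _ _ β _ _ h') ?_, ?_⟩
      · rw [add_comm γ]; exact hle.add_le _ _ γ _ _ h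
      · simp only [wdeg_add]; push_cast; ring)
    (by
      rintro i _ ⟨α, β, h, rfl⟩
      have := wdeg_le_of_weightLe ((hle.restrict _ _ _).1 h)
      omega) Finset.univ
    (G.biUnion fun g => (finite_newtonVec (A := A) (f g)).toFinset.image fun b =>
      (g.2, b.2, (wdeg w b.1 : ℤ) - wdeg w g.1)) (by
      intro e he
      simp only [Finset.mem_biUnion, Finset.mem_image, Set.Finite.mem_toFinset] at he
      obtain ⟨g, hg, b, hb, rfl⟩ := he
      exact ⟨⟨g.1, b.1, (hf g hg).2 b hb, rfl⟩, Finset.mem_univ _, Finset.mem_univ _⟩)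
  -- Only differences of the potential matter, so subtracting a lower bound makes the shifts natural
  -- numbers.
  obtain ⟨B, hB⟩ := (Set.finite_range c).bddBelow
  have hB' : ∀ i, B ≤ c i := fun i => hB ⟨i, rfl⟩
  refine ⟨fun i => (c i - B).toNat, fun g hg b hb => ?_⟩
  have h1 := hc (g.2, b.2, (wdeg w b.1 : ℤ) - wdeg w g.1) (by
    simp only [Finset.mem_biUnion, Finset.mem_image, Set.Finite.mem_toFinset]
    exact ⟨g, hg, b, hb, rfl⟩)
  have h2 := hB' g.2
  have h3 := hB' b.2
  simp only at h1 ⊢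
  omega

lemma finite_shifted_le (hw : A.IsWeight w) (c : Fin m → ℕ) (s : ℕ) :
    {a : (Fin n → ℕ) × Fin m | wdeg w a.1 + c a.2 ≤ s}.Finite :=
  (finite_sum_le_vec s).subset fun a ha =>
    (sum_le_wdeg hw.pos a.1).trans ((Nat.le_add_right _ _).trans ha)

/-- Division by a Gröbner basis: for suitable shifts of the degrees of the free generators, normal
forms modulo `K` do not increase the degree. -/
theorem exists_normal_forms (hw : A.IsWeight w) (hle : IsExtensionOfWeight w le)
    (K : Submodule R (Fin m → R)) : ∃ c : Fin m → ℕ, ∀ (s : ℕ) (a : (Fin n → ℕ) × Fin m),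
      wdeg w a.1 + c a.2 ≤ s → A.vecBasis m a ∈ K.restrictScalars k ⊔
        Submodule.span k (A.vecBasis m '' {b | b ∉ A.Exp le K ∧ wdeg w b.1 + c b.2 ≤ s}) := by
  classical
  obtain ⟨G, hGE, hG⟩ := exists_finite_generators_vec _ (isStable_Exp hw hle K)
  choose! f hfK _ hf using fun g (hg : g ∈ G) => hGE g hg
  obtain ⟨c, hc⟩ := exists_shift hle G f hf
  refine ⟨c, fun s => hle.toIsTotalOrder.induction_of_finite (finite_shifted_le hw c s) ?_⟩
  rintro ⟨α, i⟩ ha ih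
  have ha : wdeg w α + c i ≤ s := ha
  by_cases haE : (α, i) ∈ A.Exp le K
  · obtain ⟨⟨δ, j⟩, hg, hj, hle'⟩ := (hG _).1 haE
    obtain rfl : j = i := hj
    obtain ⟨γ, rfl⟩ := exists_add_of_le hle'
    simp only [wdeg_add] at ha
    have h1 := isExponentOf_basis_smul hw hle (hf _ hg) γ
    -- By the choice of `c`, the leading term of `f (δ, j)` has maximal shifted weight, so no term
    -- of the multiple exceeds `s`.
    have h2 : A.basis γ • f (δ, j) ∈
        Submodule.span k (A.vecBasis m '' {b | wdeg w b.1 + c b.2 ≤ s}) := by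
      refine basis_smul_mem_span hw γ (N := A.newtonVec (f (δ, j))) (fun b hb β hβ => ?_)
        (mem_span_vecBasis.2 subset_rfl)
      have h3 := hc _ hg b hb
      have h4 : wdeg w β ≤ wdeg w γ + wdeg w b.1 := by
        rw [← wdeg_add]
        exact hβ.elim (fun h => (congrArg _ h).le) le_of_lt
      simp only at h3
      change wdeg w β + c b.2 ≤ s
      omega
    obtain ⟨d, hd, h3⟩ := (isExponentOf_newtonVec_iff hle.toIsTotalOrder).1 h1
    simp only [add_comm γ δ] at h3
    have h4 : A.basis γ • f (δ, j) - d • A.vecBasis m (δ + γ, j) ∈ Submodule.span k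
        (A.vecBasis m '' {b | wdeg w b.1 + c b.2 ≤ s}) :=
      Submodule.sub_mem _ h2 (Submodule.smul_mem _ _ (Submodule.subset_span ⟨_, by
        simp only [Set.mem_ofPred_eq, wdeg_add]; omega, rfl⟩))
    -- The tail is both smaller for `le` and of shifted weight at most `s`, so the induction
    -- hypothesis covers each of its terms.
    have h5 : A.basis γ • f (δ, j) - d • A.vecBasis m (δ + γ, j) ∈ K.restrictScalars k ⊔
        Submodule.span k (A.vecBasis m '' {b | b ∉ A.Exp le K ∧ wdeg w b.1 + c b.2 ≤ s}) := by
      rw [mem_span_vecBasis] at h3 h4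
      refine Submodule.span_le.2 ?_ (mem_span_vecBasis.2 (Set.subset_inter h3 h4))
      rintro _ ⟨b, ⟨hb, hbs⟩, rfl⟩
      exact ih b hbs hb.1 hb.2
    have h6 : A.vecBasis m (δ + γ, j) = d⁻¹ • (A.basis γ • f (δ, j) -
        (A.basis γ • f (δ, j) - d • A.vecBasis m (δ + γ, j))) := by
      rw [sub_sub_cancel, smul_smul, inv_mul_cancel₀ hd, one_smul]
    rw [h6]
    exact Submodule.smul_mem _ _ (Submodule.sub_mem _
      (Submodule.mem_sup_left (K.smul_mem _ (hfK _ hg))) h5)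
  · exact Submodule.mem_sup_right (Submodule.subset_span ⟨_, ⟨haE, ha⟩, rfl⟩)

variable (k) in
/-- The projection `R^m → R^m / K` as a `k`-linear map. -/
noncomputable def quotientMap (K : Submodule R (Fin m → R)) :
    (Fin m → R) →ₗ[k] (Fin m → R) ⧸ K :=
  K.mkQ.restrictScalars k

lemma quotientMap_smul (K : Submodule R (Fin m → R)) (r : R) (f : Fin m → R) :
    quotientMap k K (r • f) = r • quotientMap k K f := rfl

/-- The monomials outside of `Exp(K)` are linearly independent modulo `K`. -/
theorem linearIndependent_quotientMap_vecBasis (hle : IsTotalOrder le)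
    (K : Submodule R (Fin m → R)) : LinearIndependent k
      fun a : ((A.Exp le K)ᶜ : Set ((Fin n → ℕ) × Fin m)) =>
        quotientMap k K (A.vecBasis m a) := by
  refine ((A.vecBasis m).linearIndependent.comp _ Subtype.val_injective).map
    (f := quotientMap k K) ?_
  rw [Submodule.disjoint_def]
  intro f hf hfK
  have hfK : f ∈ K := by
    simpa [quotientMap] using hfK
  rw [Set.range_comp, Subtype.range_coe, mem_span_vecBasis] at hf
  -- A nonzero `f` in `K` supported outside `Exp(K)` would have its leading exponent both inside and
  -- outside `Exp(K)`.
  by_contra hne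
  obtain ⟨a, ha⟩ := exists_isExponentOf hle (finite_newtonVec f) (newtonVec_nonempty (A := A) hne)
  exact hf ha.1 ⟨f, hfK, hne, ha⟩

/-! ### Comparison of the module filtration with the Hilbert function -/

variable (A) in
/-- The span of the `x^α e_i` of shifted weight at most `s`. -/
noncomputable def vecBelow (w : Fin n → ℕ) (c : Fin m → ℕ) (s : ℕ) : Submodule k (Fin m → R) :=
  Submodule.span k (A.vecBasis m '' {a | wdeg w a.1 + c a.2 ≤ s})

lemma vecBelow_mono {c : Fin m → ℕ} {s t : ℕ} (h : s ≤ t) :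
    A.vecBelow w c s ≤ A.vecBelow w c t :=
  Submodule.span_mono (Set.image_mono fun _ h' => le_trans h' h)

lemma exists_mem_vecBelow (w : Fin n → ℕ) (c : Fin m → ℕ) (f : Fin m → R) :
    ∃ s, f ∈ A.vecBelow w c s := by
  obtain ⟨s, hs⟩ := ((finite_newtonVec (A := A) f).image fun a => wdeg w a.1 + c a.2).bddAbove
  exact ⟨s, mem_span_vecBasis.2 fun a ha => hs ⟨a, ha, rfl⟩⟩

lemma smul_mem_vecBelow (hw : A.IsWeight w) (c : Fin m → ℕ) {s t : ℕ} {r : R}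
    (hr : r ∈ A.below w (s + 1)) {f : Fin m → R} (hf : f ∈ A.vecBelow w c t) :
    r • f ∈ A.vecBelow w c (s + t) := by
  induction hr using Submodule.span_induction with
  | mem r hr =>
    obtain ⟨γ, hγ, rfl⟩ := hr
    refine basis_smul_mem_span hw γ (fun b hb β hβ => ?_) hf
    have h1 : wdeg w γ < s + 1 := hγ
    have h2 : wdeg w b.1 + c b.2 ≤ t := hb
    have h3 : wdeg w β ≤ wdeg w γ + wdeg w b.1 := by
      rw [← wdeg_add]
      exact hβ.elim (fun h => (congrArg _ h).le) le_of_lt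
    change wdeg w β + c b.2 ≤ s + t
    omega
  | zero => rw [zero_smul]; exact Submodule.zero_mem _
  | add x y _ _ hx hy => rw [add_smul]; exact Submodule.add_mem _ hx hy
  | smul d x _ hx => rw [smul_assoc]; exact Submodule.smul_mem _ _ hx

/-- Normal forms span the image of the layer. Since the `w_i` are at least `1` and the shifts are
nonnegative, shifted weight at most `s` forces total degree at most `s`. -/
lemma finrank_map_vecBelow_le (hw : A.IsWeight w) {K : Submodule R (Fin m → R)} {c : Fin m → ℕ}
    {s : ℕ} (h : ∀ a : (Fin n → ℕ) × Fin m, wdeg w a.1 + c a.2 ≤ s →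
      A.vecBasis m a ∈ K.restrictScalars k ⊔ Submodule.span k
        (A.vecBasis m '' {b | b ∉ A.Exp le K ∧ wdeg w b.1 + c b.2 ≤ s})) :
    Module.finrank k ((A.vecBelow w c s).map (quotientMap k K)) ≤
      hilbertFunction (A.Exp le K) s := by
  have hfin : {b | b ∉ A.Exp le K ∧ wdeg w b.1 + c b.2 ≤ s}.Finite :=
    (finite_shifted_le hw c s).subset fun _ h => h.2
  have hker : (K.restrictScalars k).map (quotientMap k K) = ⊥ := by
    rw [eq_bot_iff]
    rintro _ ⟨f, hf, rfl⟩
    exact (Submodule.Quotient.mk_eq_zero K).2 hf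
  have h1 : (A.vecBelow w c s).map (quotientMap k K) ≤ Submodule.span k
      ((fun b => quotientMap k K (A.vecBasis m b)) ''
        {b | b ∉ A.Exp le K ∧ wdeg w b.1 + c b.2 ≤ s}) := by
    refine (Submodule.map_mono (Submodule.span_le.2 ?_ : A.vecBelow w c s ≤ _)).trans
      (b := Submodule.map _ (K.restrictScalars k ⊔ Submodule.span k
        (A.vecBasis m '' {b | b ∉ A.Exp le K ∧ wdeg w b.1 + c b.2 ≤ s}))) ?_
    · rintro _ ⟨a, ha, rfl⟩
      exact h a ha
    · rw [Submodule.map_sup, hker, bot_sup_eq, Submodule.map_span, Set.image_image]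
  have : FiniteDimensional k (Submodule.span k
      ((fun b => quotientMap k K (A.vecBasis m b)) ''
        {b | b ∉ A.Exp le K ∧ wdeg w b.1 + c b.2 ≤ s})) :=
    FiniteDimensional.span_of_finite k (hfin.image _)
  refine (Submodule.finrank_mono h1).trans ?_
  have := (hfin.image fun b => quotientMap k K (A.vecBasis m b)).fintype
  refine (finrank_span_le_card _).trans ?_
  rw [← Set.ncard_eq_toFinset_card']
  refine (Set.ncard_image_le hfin).trans (Set.ncard_le_ncard ?_
    ((finite_sum_le_vec s).subset fun _ h => h.2))
  exact fun b hb => ⟨hb.1, (sum_le_wdeg hw.pos b.1).trans ((Nat.le_add_right _ _).trans hb.2)⟩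

lemma finiteDimensional_map_vecBelow (hw : A.IsWeight w) (K : Submodule R (Fin m → R))
    (c : Fin m → ℕ) (s : ℕ) :
    FiniteDimensional k ((A.vecBelow w c s).map (quotientMap k K)) := by
  have : FiniteDimensional k (A.vecBelow w c s) :=
    FiniteDimensional.span_of_finite k ((finite_shifted_le hw c s).image _)
  infer_instance

/-- The slope is `D + 1` rather than `D` so that the bound tends to infinity with `s`, where the
Hilbert polynomial gives the Hilbert function. -/
lemma exists_smulSpan_le (hw : A.IsWeight w) (K : Submodule R (Fin m → R)) (c : Fin m → ℕ)
    {F : ℕ → Submodule k R} (hF : IsFinStandardFiltration k R F) {S : Set ((Fin m → R) ⧸ K)}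
    (hS : S.Finite) : ∃ D D', ∀ s, smulSpan (F s) (Submodule.span k S) ≤
      (A.vecBelow w c ((D + 1) * s + D')).map (quotientMap k K) := by
  obtain ⟨D, hD⟩ := exists_filtration_le_below hw hF
  have hS' : ∃ D', Submodule.span k S ≤ (A.vecBelow w c D').map (quotientMap k K) := by
    induction S, hS using Set.Finite.induction_on with
    | empty => exact ⟨0, by simp⟩
    | @insert y S _ _ ih =>
      obtain ⟨d, hd⟩ := ih
      obtain ⟨f, rfl⟩ := K.mkQ_surjective y
      obtain ⟨e, he⟩ := exists_mem_vecBelow (A := A) w c f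
      refine ⟨max d e, ?_⟩
      rw [Submodule.span_insert, sup_le_iff, Submodule.span_singleton_le_iff_mem]
      exact ⟨⟨f, vecBelow_mono (le_max_right _ _) he, rfl⟩,
        hd.trans (Submodule.map_mono (vecBelow_mono (le_max_left _ _)))⟩
  obtain ⟨D', hD'⟩ := hS'
  refine ⟨D, D', fun s => Submodule.span_le.2 ?_⟩
  rintro _ ⟨v, hv, u, hu, rfl⟩
  obtain ⟨f, hf, rfl⟩ := hD' hu
  refine ⟨v • f, vecBelow_mono ?_ (smul_mem_vecBelow hw c (hD s hv) hf), rfl⟩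
  nlinarith

/-- Write `x^α e_i` as `x^α` times `e_i`: the offset `t'` is a layer containing the classes of all
`e_i`, and `t` is the slope for monomials of `R`. -/
lemma exists_quotientMap_vecBasis_mem_smulSpan (K : Submodule R (Fin m → R))
    {F : ℕ → Submodule k R} (hF : IsFinStandardFiltration k R F) {S : Set ((Fin m → R) ⧸ K)}
    (hS : Submodule.span R S = ⊤) : ∃ t t', 0 < t ∧ ∀ (r : ℕ) (a : (Fin n → ℕ) × Fin m),
      ∑ l, a.1 l ≤ r → quotientMap k K (A.vecBasis m a) ∈
        smulSpan (F (t * r + t')) (Submodule.span k S) := by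
  obtain ⟨t, ht, hbasis⟩ := A.exists_basis_mem_filtration hF
  choose d hd using fun i : Fin m => exists_mem_smulSpan hF hS (quotientMap k K (Pi.single i 1))
  refine ⟨t, Finset.univ.sup d, ht, fun r a ha => ?_⟩
  have h1 : A.vecBasis m a = A.basis a.1 • Pi.single a.2 1 := by
    rw [vecBasis_apply, ← Pi.single_smul, smul_eq_mul, mul_one]
  rw [h1, quotientMap_smul]
  exact smulSpan_mono (hF.mul_le _ _) _ (smul_mem_smulSpan (hbasis r a.1 ha)
    (smulSpan_mono (hF.mono _ _ (Finset.le_sup (Finset.mem_univ a.2))) _ (hd a.2)))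

lemma hilbertFunction_le_finrank (hle : IsTotalOrder le) (K : Submodule R (Fin m → R)) {r : ℕ}
    {V : Submodule k ((Fin m → R) ⧸ K)} [FiniteDimensional k V]
    (hV : ∀ a : (Fin n → ℕ) × Fin m, ∑ l, a.1 l ≤ r → quotientMap k K (A.vecBasis m a) ∈ V) :
    hilbertFunction (A.Exp le K) r ≤ Module.finrank k V := by
  have hfin : {a : (Fin n → ℕ) × Fin m | a ∉ A.Exp le K ∧ ∑ l, a.1 l ≤ r}.Finite :=
    (finite_sum_le_vec r).subset fun _ h => h.2
  have := hfin.fintype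
  have hv : LinearIndependent k fun a : {a : (Fin n → ℕ) × Fin m | a ∉ A.Exp le K ∧
      ∑ l, a.1 l ≤ r} => quotientMap k K (A.vecBasis m a) :=
    (linearIndependent_quotientMap_vecBasis (A := A) hle K).comp
      (Set.inclusion fun _ h => h.1) (Set.inclusion_injective _)
  rw [hilbertFunction, ← Nat.card_coe_set_eq, Nat.card_eq_fintype_card, ← finrank_span_eq_card hv]
  refine Submodule.finrank_mono (Submodule.span_le.2 ?_)
  rintro _ ⟨a, rfl⟩
  exact hV a a.2.2

/-- The squeeze is `HF(s) ≤ dim R_(ts+t') M_0` and `dim R_s M_0 ≤ HF((D+1)s + D')`. -/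
theorem hasModuleGKdim_quotient (hw : A.IsWeight w) (hle : IsExtensionOfWeight w le)
    (K : Submodule R (Fin m → R)) {P : Polynomial ℚ} (hP : IsHilbertPolynomial (A.Exp le K) P) :
    HasModuleGKdim k R ((Fin m → R) ⧸ K) (degreeEReal P) := by
  refine ⟨A.exists_isFinStandardFiltration, ⟨Set.range fun i => K.mkQ (Pi.single i 1),
    Set.finite_range _, ?_⟩, fun F S hF hS hspan => ?_⟩
  · have h : Set.range (fun i : Fin m => K.mkQ (Pi.single i 1)) =
        K.mkQ '' Set.range (Pi.basisFun R (Fin m)) := by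
      rw [← Set.range_comp]
      congr 1
      ext i
      simp
    rw [h, ← Submodule.map_span, Module.Basis.span_eq, Submodule.map_top, Submodule.range_mkQ]
  · obtain ⟨c, hc⟩ := exists_normal_forms hw hle K
    obtain ⟨D, D', hD⟩ := exists_smulSpan_le hw K c hF hS
    obtain ⟨t, t', ht, htt⟩ := exists_quotientMap_vecBasis_mem_smulSpan (A := A) K hF hspan
    have hfin := finiteDimensional_map_vecBelow hw K c
    have hfin' : ∀ s, FiniteDimensional k (smulSpan (F s) (Submodule.span k S)) := fun s =>
      Submodule.finiteDimensional_of_le (hD s)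
    have hcast : ∀ {s : ℕ}, P.eval (s : ℚ) = (hilbertFunction (A.Exp le K) s : ℚ) →
        ((P.eval (s : ℚ) : ℚ) : ℝ) = (hilbertFunction (A.Exp le K) s : ℝ) := fun h => by
      rw [h]; simp
    have htend : Tendsto (fun s => (D + 1) * s + D') atTop atTop :=
      tendsto_atTop_mono (fun s => (Nat.le_mul_of_pos_left s D.succ_pos).trans
        (Nat.le_add_right _ _)) tendsto_id
    refine growthDegree_eq_degreeEReal P (D := D + 1) (D' := D') (t' := t') ht ?_ ?_ ?_
    · filter_upwards [hP] with s hs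
      rw [hs]
      exact Nat.cast_nonneg _
    · filter_upwards [htend.eventually hP] with s hs
      rw [hcast hs]
      exact_mod_cast (Submodule.finrank_mono (hD s)).trans (finrank_map_vecBelow_le hw (hc _))
    · filter_upwards [hP] with s hs
      rw [hcast hs]
      exact_mod_cast hilbertFunction_le_finrank hle.toIsTotalOrder K (htt s)

theorem hasAlgebraGKdim (A : PBWAlgebra k R n) : HasAlgebraGKdim k R ((n : ℝ) : EReal) := by
  refine ⟨A.exists_isFinStandardFiltration, fun F hF => ?_⟩
  obtain ⟨w, hw⟩ := A.exists_isWeight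
  obtain ⟨D, hD⟩ := exists_filtration_le_below hw hF
  obtain ⟨t, ht, hbasis⟩ := A.exists_basis_mem_filtration hF
  have hP : Polynomial.preHilbertPoly ℚ n 0 ≠ 0 := by
    rw [← Polynomial.leadingCoeff_ne_zero, Polynomial.leadingCoeff_preHilbertPoly]
    exact inv_ne_zero (Nat.cast_ne_zero.2 n.factorial_ne_zero)
  have heval : ∀ s : ℕ, (Polynomial.preHilbertPoly ℚ n 0).eval (s : ℚ) = ((s + n).choose n : ℕ) :=
    fun s => Polynomial.preHilbertPoly_eq_choose_sub_add ℚ n (Nat.zero_le s)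
  have hdeg : degreeEReal (Polynomial.preHilbertPoly ℚ n 0) = ((n : ℝ) : EReal) := by
    rw [degreeEReal, if_neg hP, Polynomial.natDegree_preHilbertPoly]
  rw [← hdeg]
  -- Here the polynomial equals the binomial count at every natural number, so slope `D` is harmless
  -- even if it is `0`.
  refine growthDegree_eq_degreeEReal _ (D := D) (D' := 0) (t' := 0) ht ?_ ?_ ?_
  · refine Eventually.of_forall fun s => ?_
    rw [heval]
    exact Nat.cast_nonneg _
  · refine Eventually.of_forall fun s => ?_
    rw [heval, Rat.cast_natCast, Nat.cast_le, add_zero, ← ncard_sum_le]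
    have hfin : {α : Fin n → ℕ | wdeg w α < D * s + 1}.Finite :=
      (finite_sum_le (D * s)).subset fun α hα =>
        (sum_le_wdeg hw.pos α).trans (Nat.lt_succ_iff.1 hα)
    have := finiteDimensional_below hw (A := A)
    refine (Submodule.finrank_mono (hD s)).trans ?_
    have := (hfin.image A.basis).fintype
    refine (finrank_span_le_card _).trans ?_
    rw [← Set.ncard_eq_toFinset_card']
    exact (Set.ncard_image_le hfin).trans (Set.ncard_le_ncard
      (fun α hα => (sum_le_wdeg hw.pos α).trans (Nat.lt_succ_iff.1 hα)) (finite_sum_le _))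
  · refine Eventually.of_forall fun s => ?_
    rw [heval, Rat.cast_natCast, Nat.cast_le, add_zero, ← ncard_sum_le]
    have := hF.finite (t * s)
    have := (finite_sum_le (n := n) s).fintype
    let v : {α : Fin n → ℕ | ∑ l, α l ≤ s} → F (t * s) :=
      fun α => ⟨A.basis α, hbasis s α α.2⟩
    have hv : LinearIndependent k v := by
      refine LinearIndependent.of_comp (F (t * s)).subtype ?_
      exact A.basis.linearIndependent.comp _ Subtype.val_injective
    rw [← Nat.card_coe_set_eq, Nat.card_eq_fintype_card]
    exact hv.fintype_card_le_finrank

end PBWAlgebra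

end PBW

theorem mainTheorem9 {k : Type*} {R : Type*} [Field k] [Ring R] [Algebra k R] {n : ℕ}
    (A : PBW.PBWAlgebra k R n) :
    (∀ (m : ℕ) (K : Submodule R (Fin m → R)) (w : Fin n → ℕ),
      (∀ i, 0 < w i) → (fun i => (w i : ℝ)) ∈ A.PhiQ →
      ∀ le : (Fin n → ℕ) × Fin m → (Fin n → ℕ) × Fin m → Prop,
        PBW.IsExtensionOfWeight w le →
        PBW.IsStable (A.Exp le K) ∧
        ∃ P : Polynomial ℚ, PBW.IsHilbertPolynomial (A.Exp le K) P ∧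
          PBW.HasModuleGKdim k R ((Fin m → R) ⧸ K) (PBW.degreeEReal P)) ∧
    PBW.HasAlgebraGKdim k R ((n : ℝ) : EReal) := by
  refine ⟨fun m K w hpos hw le hle => ?_, A.hasAlgebraGKdim⟩
  have hw := A.isWeight_of_mem_PhiQ hpos hw
  have hstable := PBW.PBWAlgebra.isStable_Exp hw hle K
  obtain ⟨P, hP⟩ := PBW.exists_isHilbertPolynomial _ hstable
  exact ⟨hstable, P, hP, PBW.PBWAlgebra.hasModuleGKdim_quotient hw hle K hP⟩
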